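/- **Setting.** Let $d\ge 1$. All path spaces $C^0([0,t],\mathbb R^d)$ carry the uniform topology and its Borel $\sigma$-algebra, $\mathcal P(\cdot)$ denotes Borel probability measures, and $\pi^t:C^0([0,1],\mathbb R^d)\to C^0([0,t],\mathbb R^d)$ is the restriction map. Let $\mathcal V$ be the set of velocity fields $u\in C^\infty_{\rm loc}((0,1]\times\mathbb R^d;\mathbb R^d)\cap L^1([0,1],C^0(\mathbb R^d))$, i.e. $u$ is smooth on $(0,1]\times\mathbb R^d$ and $\int_0^1\sup_x|u(t,x)|\,dt<\infty$, with the $\sigma$-algebra generated by the evaluations $u\mapsto u(t,x)$, $(t,x)\in(0,1]\times\mathbb R^d$ (the Borel $\sigma$-algebra inherited from $C^\infty_{\rm loc}$). For $u\in\mathcal V$, $y\in\mathbb R^d$ consider $$dX_t=u(t,X_t)\,dt+dW_t,\qquad X_0=y. \tag{1}$$ * For a deterministic $W\in C^0([0,1],\mathbb R^d)$, a *Carathéodory solution* of (1) is $X\in C^0([0,1],\mathbb R^d)$ with $X_t=y+\int_0^tu(s,X_s)\,ds+W_t-W_0$ for all $t\in[0,1]$. For $s\in(0,1]$ and $x\in\mathbb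 R^d$, $t\mapsto X^{s,x,u,W}_t$, $t\in[s,1]$, is the unique solution of $X_t=x+\int_s^tu(r,X_r)\,dr+W_t-W_s$. * A *weak solution* of (1) with driving noise $\mathbb W\in\mathcal P(C^0([0,1],\mathbb R^d))$ is $\mathbb X(dX,dW)\in\mathcal P(C^0([0,1],\mathbb R^d)^2)$ such that (i) its $W$-marginal is $\mathbb W$; (ii) for every $t\in[0,1]$, under $\mathbb X$, $\pi^tX$ and $W$ are conditionally independent given $\pi^tW$; (iii) $\mathbb X$-a.s., $X$ is a Carathéodory solution of (1) for the noise path $W$. *Weak uniqueness* means that any two weak solutions are equal. * A *coupling of two weak solutions* is a probability measure $\mathbb Y(dX^1,dX^2,dW)$ on $C^0([0,1],\mathbb R^d)^3$ whose marginals in $(X^1,W)$ and in $(X^2,W)$ are both weak solutions of (1). *Pathwise uniqueness* means that $X^1=X^2$ $\mathbb Y$-a.s. for every such $\mathbb Y$; *pathwise nonuniqueness* is its failure. * $\mathbb W$ is a *regular driving noise* if for every $t\in[0,1]$ the conditional law of $W$ given $\pi^tW$ has a representative $w\mapsto\mathbb W(d\tilde W\mid w)$, $w\in C^0([0,t],\mathbb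 R^d)$, that is continuous for the weak topology on probability measures. * For times $T^n\in(0,1]$ with $T^n\to0$, a law $\mathbb U\in\mathcal P(\mathcal V)$ is *explosively separating* for $(T^n)$ and $W\in C^0([0,1],\mathbb R^d)$ if $$\lim_{n\to\infty}\limsup_{\delta\to0^+}\ \limsup_{|x-z|\to0,\ x\neq z}\ \limsup_{m\to\infty}\ \mathbb U\big(|X^{T^m,x,u,W}_{T^n}-X^{T^m,z,u,W}_{T^n}|<\delta\big)=0 .$$ **Theorem.** Let $\mathbb W$ be a regular driving noise, let $\mathbb U\in\mathcal P(\mathcal V)$ be the law of a random velocity field independent of the noise, and let $T^n\in(0,1]$, $T^n\to0$, be such that $\mathbb U$ is explosively separating for $(T^n)$ and $\mathbb W$-almost every $W$. Then for every $y\in\mathbb R^d$ and for $\mathbb U$-almost every $u$, equation (1) with driving noise $\mathbb W$ exhibits pathwise nonuniqueness, and moreover: 1. for every $\varepsilon\in(0,1]$ and $\gamma>0$ there is a coupling $\mathbb Y$ of two weak solutions of (1) with $\mathbb Y(X^1|_{[0,\varepsilon]}=X^2|_{[0,\varepsilon]})\le\gamma$; 2. there is a weak solution $\mathbb X(dX,dW)$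 of (1) such that for every $\varepsilon\in(0,1]$, for $\mathbb W$-almost every $W$, the conditional law $\pi^\varepsilon_*\mathbb X(d\tilde X\mid W)$ of $X|_{[0,\varepsilon]}$ given $W$ has more than one path in its support; 3. if weak uniqueness holds for (1), then for every $\varepsilon\in(0,1]$ there is a coupling $\mathbb Y$ of two weak solutions of (1) with $\mathbb Y(X^1|_{[0,\varepsilon]}=X^2|_{[0,\varepsilon]})=0$. Also, for every $y\in\mathbb R^d$ and for $\mathbb U\otimes\mathbb W$-almost every $(u,W)$: for every $\varepsilon\in(0,1]$, equation (1) has two Carathéodory solutions on $[0,1]$ that do not coincide on $[0,\varepsilon]$. -/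

import Mathlib

open MeasureTheory ProbabilityTheory Filter Topology
open scoped unitInterval ENNReal ContDiff

noncomputable section

namespace AdditiveSDE

/-- The state space `ℝᵈ` with its Euclidean norm. -/
abbrev Space (d : ℕ) : Type := EuclideanSpace ℝ (Fin d)

/-- The path space `C⁰([0,1], ℝᵈ)` with the topology of uniform convergence. -/
abbrev PathSpace (d : ℕ) : Type := C(I, Space d)

/-- The path space `C⁰([0,t], ℝᵈ)` for `t ∈ [0,1]`; here `Set.Iic t` is `[0,t]` as a subset
of `[0,1]`. -/
abbrev PathSpaceUpTo (d : ℕ) (t : I) : Type := C(Set.Iic t, Space d)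

/-- Spaces of continuous functions carry their Borel `σ`-algebra. -/
instance instMeasurableSpacePaths {X : Type*} [TopologicalSpace X] (d : ℕ) :
    MeasurableSpace C(X, Space d) := borel _

instance instBorelSpacePaths {X : Type*} [TopologicalSpace X] (d : ℕ) :
    BorelSpace C(X, Space d) := ⟨rfl⟩

/-- The restriction map `π^t : C⁰([0,1], ℝᵈ) → C⁰([0,t], ℝᵈ)`. -/
def restr {d : ℕ} (t : I) (X : PathSpace d) : PathSpaceUpTo d t :=
  X.restrict (Set.Iic t)

theorem continuous_restr {d : ℕ} (t : I) : Continuous (restr (d := d) t) :=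
  ContinuousMap.continuous_restrict _

theorem measurable_restr {d : ℕ} (t : I) : Measurable (restr (d := d) t) :=
  (continuous_restr t).measurable

/-- The value of a path at a real time (only used for times in `[0,1]`). -/
def at_ {d : ℕ} (X : PathSpace d) (r : ℝ) : Space d :=
  X (Set.projIcc 0 1 zero_le_one r)

/-- A velocity field in `C^∞_loc((0,1] × ℝᵈ) ∩ L¹([0,1], C⁰(ℝᵈ))`: smooth on `(0,1] × ℝᵈ` (up to
and including the time `1`) with `∫₀¹ sup_x |u(t,x)| dt < ∞`. Since only the values at times in
`(0,1]` are meaningful, the field is normalized to vanish at all other times. -/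
structure VelocityField (d : ℕ) where
  toFun : ℝ → Space d → Space d
  smooth : ContDiffOn ℝ ∞ (fun p : ℝ × Space d => toFun p.1 p.2)
    (Set.Ioc (0 : ℝ) 1 ×ˢ (Set.univ : Set (Space d)))
  integrable : ∫⁻ t in Set.Ioc (0 : ℝ) 1, ⨆ x : Space d, ‖toFun t x‖ₑ < ⊤
  eq_zero : ∀ t, t ∉ Set.Ioc (0 : ℝ) 1 → toFun t = 0

instance instCoeFunVelocityField (d : ℕ) :
    CoeFun (VelocityField d) (fun _ => ℝ → Space d → Space d) := ⟨VelocityField.toFun⟩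

/-- The `σ`-algebra on velocity fields generated by the point evaluations `u ↦ u(t,x)`. It is the
trace of the Borel `σ`-algebra of the Polish space `C^∞_loc((0,1] × ℝᵈ)`. -/
instance instMeasurableSpaceVelocityField (d : ℕ) : MeasurableSpace (VelocityField d) :=
  MeasurableSpace.comap VelocityField.toFun MeasurableSpace.pi

/-- `X` is a Carathéodory solution on `[0,1]` of `dX = u(t,X) dt + dW`, `X₀ = y`. -/
def IsCaratheodorySolution {d : ℕ} (u : VelocityField d) (y : Space d) (W X : PathSpace d) :
    Prop :=
  ∀ t : I, X t = y + (∫ r in (0 : ℝ)..t, u r (at_ X r)) + W t - W 0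

/-- `X` solves `dX = u(t,X) dt + dW` on `[s,1]` with `X_s = x`; before the time `s` the path is
extended by the constant `x`. -/
def IsSolutionFrom {d : ℕ} (u : VelocityField d) (s : I) (x : Space d) (W X : PathSpace d) :
    Prop :=
  (∀ t : I, t ≤ s → X t = x) ∧
    ∀ t : I, s ≤ t → X t = x + (∫ r in (s : ℝ)..t, u r (at_ X r)) + W t - W s

open Classical in
/-- The path `t ↦ X^{s,x,u,W}_t`, i.e. the solution started from `x` at the time `s > 0`, which
exists and is unique because `u` is smooth at positive times and `∫₀¹ sup_x |u(t,x)| dt < ∞`. -/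
def flow {d : ℕ} (s : I) (x : Space d) (u : VelocityField d) (W : PathSpace d) : PathSpace d :=
  if h : ∃ X : PathSpace d, IsSolutionFrom u s x W X then h.choose else 0

/-- The random velocity field with law `𝕌` is explosively separating for the times `T n` and the
noise path `W`. The filter `comap dist (𝓝[>] 0)` on pairs of points expresses `|x - y| → 0` along
pairs of distinct points. -/
def ExplosivelySeparating {d : ℕ} (𝕌 : ProbabilityMeasure (VelocityField d)) (T : ℕ → I)
    (W : PathSpace d) : Prop :=
  Tendsto
    (fun n : ℕ =>
      limsup (fun δ : ℝ =>
        limsup (fun p : Space d × Space d =>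
          limsup (fun m : ℕ =>
            (𝕌 : Measure (VelocityField d))
              {u | dist (flow (T m) p.1 u W (T n)) (flow (T m) p.2 u W (T n)) < δ})
            atTop)
          (comap (fun p : Space d × Space d => dist p.1 p.2) (𝓝[>] 0)))
        (𝓝[>] 0))
    atTop (𝓝 (0 : ℝ≥0∞))

/-- The noise law `𝕎` is regular: for every `t`, the conditional law of `W` given `π^t W` has a
representative which is continuous for the weak topology on probability measures. -/
def IsRegularNoise {d : ℕ} (𝕎 : ProbabilityMeasure (PathSpace d)) : Prop :=
  ∀ t : I, ∃ κ : PathSpaceUpTo d t → ProbabilityMeasure (PathSpace d), Continuous κ ∧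
    ∀ᵐ w ∂((𝕎 : Measure (PathSpace d)).map (restr t)),
      condDistrib (fun W : PathSpace d => W) (restr t) (𝕎 : Measure (PathSpace d)) w = κ w

/-- Weak solutions: joint laws `𝕏(dX, dW)` of a solution and the noise. -/
structure IsWeakSolution {d : ℕ} (u : VelocityField d) (y : Space d)
    (𝕎 : ProbabilityMeasure (PathSpace d))
    (𝕏 : ProbabilityMeasure (PathSpace d × PathSpace d)) : Prop where
  /-- The marginal law of the noise is `𝕎`. -/
  marginal : (𝕏 : Measure (PathSpace d × PathSpace d)).map Prod.snd = 𝕎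
  /-- `π^t X` and `W` are conditionally independent given `π^t W`. -/
  nonanticipating : ∀ t : I,
    CondIndepFun
      (MeasurableSpace.comap (fun p : PathSpace d × PathSpace d => restr t p.2) inferInstance)
      ((measurable_restr t).comp measurable_snd).comap_le
      (fun p : PathSpace d × PathSpace d => restr t p.1)
      (fun p : PathSpace d × PathSpace d => p.2)
      (𝕏 : Measure (PathSpace d × PathSpace d))
  /-- Almost surely the equation holds. -/
  solves : ∀ᵐ p ∂(𝕏 : Measure (PathSpace d × PathSpace d)), IsCaratheodorySolution u y p.2 p.1

/-- Any two weak solutions coincide. -/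
def WeakUniqueness {d : ℕ} (u : VelocityField d) (y : Space d)
    (𝕎 : ProbabilityMeasure (PathSpace d)) : Prop :=
  ∀ 𝕏 𝕏' : ProbabilityMeasure (PathSpace d × PathSpace d),
    IsWeakSolution u y 𝕎 𝕏 → IsWeakSolution u y 𝕎 𝕏' → 𝕏 = 𝕏'

/-- `𝕐(dX¹, dX², dW)` is a coupling of two weak solutions with the same noise: both marginals
`𝕐(dX¹, dW)` and `𝕐(dX², dW)` are weak solutions. -/
def IsWeakCoupling {d : ℕ} (u : VelocityField d) (y : Space d)
    (𝕎 : ProbabilityMeasure (PathSpace d))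
    (𝕐 : ProbabilityMeasure (PathSpace d × PathSpace d × PathSpace d)) : Prop :=
  IsWeakSolution u y 𝕎
      (𝕐.map (f := fun p => (p.1, p.2.2)) (by fun_prop)) ∧
    IsWeakSolution u y 𝕎
      (𝕐.map (f := fun p => (p.2.1, p.2.2)) (by fun_prop))

/-- Pathwise uniqueness: in every coupling of two weak solutions, the solutions coincide almost
surely. -/
def PathwiseUniqueness {d : ℕ} (u : VelocityField d) (y : Space d)
    (𝕎 : ProbabilityMeasure (PathSpace d)) : Prop :=
  ∀ 𝕐 : ProbabilityMeasure (PathSpace d × PathSpace d × PathSpace d),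
    IsWeakCoupling u y 𝕎 𝕐 →
      ∀ᵐ p ∂(𝕐 : Measure (PathSpace d × PathSpace d × PathSpace d)), p.1 = p.2.1

/-- The law `π^ε_* 𝕏(dX̃ | W)` of `X|_{[0,ε]}` under the conditional law of `X` given `W`. -/
def condLawUpTo {d : ℕ} (𝕏 : ProbabilityMeasure (PathSpace d × PathSpace d)) (ε : I)
    (W : PathSpace d) : Measure (PathSpaceUpTo d ε) :=
  (condDistrib (fun p : PathSpace d × PathSpace d => p.1) (fun p => p.2)
    (𝕏 : Measure (PathSpace d × PathSpace d)) W).map (restr ε)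

/-- The event `X¹|_{[0,ε]} = X²|_{[0,ε]}` for a triple `(X¹, X², W)`. -/
def coincidence (d : ℕ) (ε : I) : Set (PathSpace d × PathSpace d × PathSpace d) :=
  {p | restr ε p.1 = restr ε p.2.1}

end AdditiveSDE

end

/-!
Let solutions `X`, `Z` of the equation start at the small times `T^m`, from `y` and from a point
`z ≠ y`, and let first `m → ∞` and then `z → y`. Explosive separation forbids `X` and `Z` to merge:
along suitable diagonal sequences they are, with high probability, a fixed distance apart at an
arbitrarily small time. All drift parts lie in one compact set of paths, having the common modulus
of continuity `∫ sup_x |u|`, so that for a fixed noise path the limit points of `(X, Z)` are pairs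
of distinct Carathéodory solutions started from `y`.

Likewise the laws of `(X, Z, W)` are tight, and their limits are couplings of two weak solutions:
conditional independence passes to the limit because it reads
`law(π^t W, π^t X, W) = law(π^t W, π^t X) ⊗ 𝕎(dW | π^t W)` with a weakly continuous kernel.

A countable mixture of the marginals of such couplings is a weak solution that dominates all of
them; if its conditional laws given `W` were Dirac masses on a set of noise paths of positive
measure, every coupling would coincide there. Under weak uniqueness all these couplings are
couplings of one law with itself, so the atoms of its conditional laws have mass at most `1/2`.
Coupling the conditional quantiles at levels differing by `1/2` then makes coincidence a null event.
-/

noncomputable section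

namespace AdditiveSDE

/-! ### Iterated contractions, limits and compactness -/

/-- Weissinger's fixed point theorem. -/
theorem exists_isFixedPt_tendsto_iterate {α : Type*} [MetricSpace α] [CompleteSpace α]
    {Φ : α → α} {S : Set α} (hS : IsClosed S) (hne : S.Nonempty) (hΦ : Set.MapsTo Φ S S)
    {c : ℕ → ℝ} (hc : Summable c)
    (h : ∀ n, ∀ x ∈ S, ∀ y ∈ S, dist (Φ^[n] x) (Φ^[n] y) ≤ c n * dist x y) :
    ∃ x₀, Function.IsFixedPt Φ x₀ ∧ ∀ x ∈ S, Tendsto (fun n => Φ^[n] x) atTop (𝓝 x₀) := by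
  obtain ⟨x, hx⟩ := hne
  have hdist (n : ℕ) : dist (Φ^[n] x) (Φ^[n + 1] x) ≤ c n * dist x (Φ x) :=
    h n x hx (Φ x) (hΦ hx)
  obtain ⟨x₀, hx₀⟩ := cauchySeq_tendsto_of_complete
    (cauchySeq_of_dist_le_of_summable _ hdist (hc.mul_right _))
  have hx₀S : x₀ ∈ S := hS.mem_of_tendsto hx₀ (.of_forall fun n => hΦ.iterate n hx)
  have hfix : Φ x₀ = x₀ := by
    have hlim : Tendsto (fun n => Φ (Φ^[n] x)) atTop (𝓝 (Φ x₀)) := by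
      rw [tendsto_iff_dist_tendsto_zero] at hx₀ ⊢
      exact squeeze_zero (fun _ => dist_nonneg)
        (fun n => h 1 _ (hΦ.iterate n hx) _ hx₀S) (by simpa using hx₀.const_mul (c 1))
    refine tendsto_nhds_unique hlim ((hx₀.comp (tendsto_add_atTop_nat 1)).congr fun n => ?_)
    exact Function.iterate_succ_apply' Φ n x
  refine ⟨x₀, hfix, fun z hz => ?_⟩
  rw [tendsto_iff_dist_tendsto_zero]
  refine squeeze_zero (fun _ => dist_nonneg) (fun n => ?_)
    (by simpa using hc.tendsto_atTop_zero.mul_const (dist z x₀))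
  simpa only [Function.iterate_fixed hfix] using h n z hz x₀ hx₀S

theorem isCompact_setOf_dist_le {X E : Type*} [TopologicalSpace X] [CompactSpace X]
    [MetricSpace E] [ProperSpace E] (G : C(X, ℝ)) (x₀ : X) (c : E) :
    IsCompact {A : C(X, E) | A x₀ = c ∧ ∀ x x', dist (A x) (A x') ≤ |G x - G x'|} := by
  set S := {A : C(X, E) | A x₀ = c ∧ ∀ x x', dist (A x) (A x') ≤ |G x - G x'|}
  have hmodulus (x : X) : Tendsto (fun x' => |G x - G x'|) (𝓝 x) (𝓝 0) := by
    have : Continuous fun x' => |G x - G x'| := by fun_prop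
    simpa using this.tendsto x
  refine ArzelaAscoli.isCompact_of_equicontinuous _ ?_ fun x =>
    Metric.equicontinuousAt_of_continuity_modulus _ (hmodulus x) _
      (.of_forall fun x' (A : S) => A.2.2 x x')
  have himage : ContinuousMap.toFun '' S =
      {f : X → E | f x₀ = c ∧ ∀ x x', dist (f x) (f x') ≤ |G x - G x'|} := by
    refine Set.Subset.antisymm (Set.image_subset_iff.mpr fun A hA => hA) fun f hf => ?_
    have hcont : Continuous f := continuous_iff_continuousAt.mpr fun x =>
      tendsto_iff_dist_tendsto_zero.mpr <| squeeze_zero (fun _ => dist_nonneg)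
        (fun x' => by rw [dist_comm]; exact hf.2 x x') (hmodulus x)
    exact ⟨⟨f, hcont⟩, hf, rfl⟩
  rw [himage]
  refine (isCompact_univ_pi fun x => isCompact_closedBall c |G x - G x₀|).of_isClosed_subset ?_ ?_
  · simp only [Set.ofPred_and, Set.ofPred_forall]
    exact (isClosed_eq (by fun_prop) continuous_const).inter (isClosed_iInter fun x =>
      isClosed_iInter fun x' => isClosed_le (by fun_prop) continuous_const)
  · rintro f ⟨h₀, hf⟩ x -
    exact h₀ ▸ hf x x₀

theorem measurable_of_forall_eval {X Ω : Type*} [TopologicalSpace X] [CompactSpace X]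
    [SecondCountableTopology X] [LocallyCompactSpace X] [MeasurableSpace Ω] {d : ℕ}
    {f : Ω → C(X, Space d)} (h : ∀ x, Measurable fun a => f a x) : Measurable f := by
  rcases isEmpty_or_nonempty X with _ | _
  · exact measurable_of_subsingleton_codomain f
  let ev (g : C(X, Space d)) (n : ℕ) : Space d := g (TopologicalSpace.denseSeq X n)
  have hev : Continuous ev := by fun_prop
  have hinj : Function.Injective ev := fun g g' hg => ContinuousMap.ext <| congrFun <|
    (TopologicalSpace.denseRange_denseSeq X).equalizer g.continuous g'.continuous hg
  exact (hev.measurableEmbedding hinj).measurable_comp_iff.mp (measurable_pi_lambda _ fun n => h _)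

theorem limsup_comp_le {ι κ : Type*} {l : Filter ι} {l' : Filter κ} {f : κ → ℝ≥0∞} {φ : ι → κ}
    (hφ : Tendsto φ l l') : limsup (f ∘ φ) l ≤ limsup f l' := by
  rw [limsup, ← Filter.map_map]
  exact limsSup_le_limsSup_of_le (map_mono hφ)

theorem limsup_limsup_comp_le {ι κ α β : Type*} {l : Filter ι} {l' : Filter κ} {m : Filter α}
    {m' : Filter β} (f : α → β → ℝ≥0∞) {φ : ι → α} {ψ : κ → β} (hφ : Tendsto φ l m)
    (hψ : Tendsto ψ l' m') :
    limsup (fun i => limsup (fun k => f (φ i) (ψ k)) l') l ≤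
      limsup (fun a => limsup (f a) m') m :=
  (limsup_le_limsup (.of_forall fun _ => limsup_comp_le hψ)).trans
    (limsup_comp_le (f := fun a => limsup (f a) m') hφ)

theorem limsup_le_lintegral_limsup {Ω : Type*} [MeasurableSpace Ω] {μ : Measure Ω}
    [IsFiniteMeasure μ] {F : ℕ → ℝ≥0∞} {f : ℕ → Ω → ℝ≥0∞} (hf : ∀ n, Measurable (f n))
    (hf₁ : ∀ n o, f n o ≤ 1) (hF : ∀ n, F n ≤ ∫⁻ o, f n o ∂μ) :
    limsup F atTop ≤ ∫⁻ o, limsup (fun n => f n o) atTop ∂μ :=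
  (limsup_le_limsup (.of_forall hF)).trans <|
    limsup_lintegral_le 1 hf (fun n => ae_of_all _ (hf₁ n)) (by simp [measure_ne_top])

theorem ae_tendsto_liminf_zero {Ω : Type*} [MeasurableSpace Ω] {μ : Measure Ω}
    {f : ℕ → ℕ → Ω → ℝ≥0∞} {c : ℕ → ℝ≥0∞} (hf : ∀ j k, Measurable (f j k))
    (hc : ∑' j, c j ≠ ⊤) (h : ∀ j, ∃ᶠ k in atTop, ∫⁻ o, f j k o ∂μ ≤ c j) :
    ∀ᵐ o ∂μ, Tendsto (fun j => liminf (fun k => f j k o) atTop) atTop (𝓝 0) := by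
  have hliminf (j : ℕ) : Measurable fun o => liminf (fun k => f j k o) atTop := .liminf (hf j)
  have hsum : ∫⁻ o, ∑' j, liminf (fun k => f j k o) atTop ∂μ ≠ ⊤ := by
    rw [lintegral_tsum fun j => (hliminf j).aemeasurable]
    refine ne_top_of_le_ne_top hc (ENNReal.tsum_le_tsum fun j => ?_)
    exact (lintegral_liminf_le (hf j)).trans (liminf_le_of_frequently_le' (h j))
  filter_upwards [ae_lt_top (.tsum hliminf) hsum] with o ho
    using ENNReal.tendsto_atTop_zero_of_tsum_ne_top ho.ne

theorem exists_tendsto_atTop_of_eventually_eventually {P : ℕ → ℕ → ℕ → Prop}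
    (h : ∀ j, ∀ᶠ k in atTop, ∀ᶠ m in atTop, P j k m) :
    ∃ M : ℕ → ℕ, Tendsto M atTop atTop ∧ ∀ j, ∀ᶠ k in atTop, P j k (M k) := by
  have hM (k : ℕ) : ∃ m ≥ k, ∀ j < k, (∀ᶠ m in atTop, P j k m) → P j k m := by
    have (j : ℕ) : ∀ᶠ m in atTop, (∀ᶠ m in atTop, P j k m) → P j k m := by
      by_cases hj : ∀ᶠ m in atTop, P j k m
      · exact hj.mono fun _ hm _ => hm
      · exact .of_forall fun _ hm => absurd hm hj
    exact ((eventually_ge_atTop k).and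
      ((Set.finite_Iio k).eventually_all.mpr fun j _ => this j)).exists
  choose M hkM hM using hM
  refine ⟨M, tendsto_atTop_mono hkM tendsto_id, fun j => ?_⟩
  filter_upwards [h j, eventually_gt_atTop j] with k hk hjk using hM k j hjk hk

/-! ### Limits of laws -/

section WeakLimits

theorem exists_ultrafilter_tendsto {Ω : Type*} [TopologicalSpace Ω] [T2Space Ω]
    [MeasurableSpace Ω] [BorelSpace Ω] {ι : Type*} (l : Filter ι) [l.NeBot]
    {μs : ι → ProbabilityMeasure Ω}
    (h : IsTightMeasureSet (Set.range fun i => (μs i : Measure Ω))) :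
    ∃ g : Ultrafilter ι, g ≤ l ∧ ∃ μ, Tendsto μs g (𝓝 μ) := by
  have hrange : {x | ∃ μ ∈ Set.range μs, (μ : Measure Ω) = x} =
      Set.range fun i => (μs i : Measure Ω) := (Set.range_comp _ μs).symm
  have hmem : Set.range μs ∈ (Ultrafilter.of l).map μs := Filter.mem_map.mpr (by simp)
  obtain ⟨μ, -, hμ⟩ := (isCompact_closure_of_isTightMeasureSet (hrange ▸ h)).ultrafilter_le_nhds
    ((Ultrafilter.of l).map μs) (le_principal_iff.mpr (mem_of_superset hmem subset_closure))
  exact ⟨Ultrafilter.of l, Ultrafilter.of_le l, μ, hμ⟩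

theorem ae_exists_tendsto_of_tendsto {Ω : Type*} [PseudoMetricSpace Ω] [MeasurableSpace Ω]
    [OpensMeasurableSpace Ω] {l : Filter ℕ} [l.NeBot] (hl : l ≤ atTop)
    {μs : ℕ → ProbabilityMeasure Ω} {μ : ProbabilityMeasure Ω} (h : Tendsto μs l (𝓝 μ))
    {A : ℕ → Set Ω} (hA : ∀ k, ∀ᵐ p ∂(μs k : Measure Ω), p ∈ A k) :
    ∀ᵐ p ∂(μ : Measure Ω), ∃ (φ : ℕ → ℕ) (q : ℕ → Ω),
      Tendsto φ atTop atTop ∧ (∀ n, q n ∈ A (φ n)) ∧ Tendsto q atTop (𝓝 p) := by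
  have hmem : ∀ n, ∀ᵐ p ∂(μ : Measure Ω), p ∈ closure (⋃ k ≥ n, A k) := fun n => by
    have hμs : ∀ᶠ k in l, (μs k : Measure Ω) (closure (⋃ k ≥ n, A k)) = 1 := by
      filter_upwards [hl (eventually_ge_atTop n)] with k hk
      refine (mem_ae_iff_prob_eq_one isClosed_closure.measurableSet).mp ?_
      filter_upwards [hA k] with p hp
      exact subset_closure (Set.mem_biUnion (Set.mem_ofPred.mpr hk) hp)
    have hlim := ProbabilityMeasure.limsup_measure_closed_le_of_tendsto h
      (isClosed_closure (s := ⋃ k ≥ n, A k))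
    rw [limsup_congr hμs, limsup_const] at hlim
    exact (prob_compl_eq_zero_iff isClosed_closure.measurableSet).mpr (le_antisymm prob_le_one hlim)
  filter_upwards [ae_all_iff.mpr hmem] with p hp
  have hnear : ∀ n : ℕ, ∃ k q, n ≤ k ∧ q ∈ A k ∧ dist q p < 1 / ((n : ℝ) + 1) := fun n => by
    obtain ⟨q, hq, hd⟩ := Metric.mem_closure_iff.mp (hp n) _ (Nat.one_div_pos_of_nat (n := n))
    obtain ⟨k, hk, hqk⟩ := Set.mem_iUnion₂.mp hq
    exact ⟨k, q, hk, hqk, dist_comm p q ▸ hd⟩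
  choose φ q hφ hq hd using hnear
  exact ⟨φ, q, tendsto_atTop_mono hφ tendsto_id, hq, tendsto_iff_dist_tendsto_zero.mpr
    (squeeze_zero (fun _ => dist_nonneg) (fun n => (hd n).le)
      tendsto_one_div_add_atTop_nhds_zero_nat)⟩

variable {A F : Type*} [TopologicalSpace A] [MeasurableSpace A] [BorelSpace A]
  [TopologicalSpace F] [MeasurableSpace F] [BorelSpace F] [SecondCountableTopology F]

theorem integral_mul_compProd (ν : Measure A) [IsFiniteMeasure ν] (κ : Kernel A F)
    [IsMarkovKernel κ] (f : BoundedContinuousFunction A ℝ) (g : BoundedContinuousFunction F ℝ) :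
    ∫ p, f p.1 * g p.2 ∂(ν ⊗ₘ κ) = ∫ a, f a * ∫ x, g x ∂κ a ∂ν := by
  rw [Measure.integral_compProd]
  · simp only [integral_const_mul]
  · exact (f.compContinuous ⟨Prod.fst, continuous_fst⟩ *
      g.compContinuous ⟨Prod.snd, continuous_snd⟩).integrable _

variable [HasOuterApproxClosed A] [HasOuterApproxClosed F]

theorem eq_compProd_of_tendsto {ι : Type*} {l : Filter ι} [l.NeBot] {κ : Kernel A F}
    [IsMarkovKernel κ] {κ' : A → ProbabilityMeasure F} (hκ' : Continuous κ')
    {ρs : ι → ProbabilityMeasure (A × F)} {ρ : ProbabilityMeasure (A × F)}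
    (h : Tendsto ρs l (𝓝 ρ))
    (hκs : ∀ i, ∀ᵐ a ∂(ρs i : Measure (A × F)).fst, κ a = κ' a)
    (hκ : ∀ᵐ a ∂(ρ : Measure (A × F)).fst, κ a = κ' a)
    (hρs : ∀ i, (ρs i : Measure (A × F)) = (ρs i : Measure (A × F)).fst ⊗ₘ κ) :
    (ρ : Measure (A × F)) = (ρ : Measure (A × F)).fst ⊗ₘ κ := by
  refine Measure.ext_of_integral_mul_boundedContinuousFunction fun f g => ?_
  have hg : Continuous fun a => ∫ x, g x ∂(κ' a : Measure F) := continuous_iff_continuousAt.mpr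
    fun a => ProbabilityMeasure.tendsto_iff_forall_integral_tendsto.mp (hκ'.tendsto a) g
  let F₁ : BoundedContinuousFunction (A × F) ℝ :=
    f.compContinuous ⟨Prod.fst, continuous_fst⟩ * g.compContinuous ⟨Prod.snd, continuous_snd⟩
  let F₂ : BoundedContinuousFunction (A × F) ℝ :=
    f.compContinuous ⟨Prod.fst, continuous_fst⟩ *
      (BoundedContinuousFunction.ofNormedAddCommGroup _ hg ‖g‖ fun a =>
        g.norm_integral_le_norm _).compContinuous ⟨Prod.fst, continuous_fst⟩
  have hF₂ : ∀ η : ProbabilityMeasure (A × F), (∀ᵐ a ∂(η : Measure (A × F)).fst, κ a = κ' a) →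
      ∫ p, f p.1 * g p.2 ∂((η : Measure (A × F)).fst ⊗ₘ κ) =
        ∫ p, F₂ p ∂(η : Measure (A × F)) := fun η hη => by
    have hmap : ∫ p, F₂ p ∂(η : Measure (A × F)) =
        ∫ a, f a * ∫ x, g x ∂(κ' a : Measure F) ∂(η : Measure (A × F)).fst :=
      (integral_map (f := fun a => f a * ∫ x, g x ∂(κ' a : Measure F)) measurable_fst.aemeasurable
        (f.continuous.mul hg).aestronglyMeasurable).symm
    rw [integral_mul_compProd, hmap]
    exact integral_congr_ae (hη.mono fun a ha => by simp only [ha])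
  have h₁ := ProbabilityMeasure.tendsto_iff_forall_integral_tendsto.mp h F₁
  have h₂ := ProbabilityMeasure.tendsto_iff_forall_integral_tendsto.mp h F₂
  rw [hF₂ ρ hκ]
  refine tendsto_nhds_unique h₁ (h₂.congr fun i => ?_)
  rw [← hF₂ _ (hκs i), ← hρs i]
  rfl

end WeakLimits

section CondIndep

variable {Ω A B F : Type*} {mΩ : MeasurableSpace Ω} [StandardBorelSpace Ω]
  {mA : MeasurableSpace A} {mB : MeasurableSpace B} {mF : MeasurableSpace F}
  [StandardBorelSpace B] [Nonempty B] [StandardBorelSpace F] [Nonempty F]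

theorem condIndepFun_iff_map_eq_compProd {μ : Measure Ω} [IsFiniteMeasure μ] {k : Ω → A}
    {X : Ω → B} {Y : Ω → F} (hk : Measurable k) (hX : Measurable X) (hY : Measurable Y)
    {κ : Kernel A F} [IsMarkovKernel κ] (hκ : condDistrib Y k μ =ᵐ[μ.map k] κ) :
    X ⟂ᵢ[k, hk; μ] Y ↔ μ.map (fun o => ((k o, X o), Y o)) =
      μ.map (fun o => (k o, X o)) ⊗ₘ κ.prodMkRight B := by
  rw [condIndepFun_iff_condDistrib_prod_ae_eq_prodMkRight hY hX hk,
    condDistrib_ae_eq_iff_measure_eq_compProd _ hY.aemeasurable]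
  have hκ' : (condDistrib Y k μ).prodMkRight B =ᵐ[μ.map fun o => (k o, X o)] κ.prodMkRight B := by
    have hfst : (μ.map fun o => (k o, X o)).map Prod.fst = μ.map k :=
      Measure.map_map measurable_fst (hk.prodMk hX)
    rw [← hfst] at hκ
    exact ae_of_ae_map measurable_fst.aemeasurable hκ
  rw [Measure.compProd_congr hκ']

theorem condIndepFun_map_iff {Ω' : Type*} {mΩ' : MeasurableSpace Ω'} [StandardBorelSpace Ω']
    {μ : Measure Ω'} [IsFiniteMeasure μ] {φ : Ω' → Ω} (hφ : Measurable φ) {k : Ω → A}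
    {X : Ω → B} {Y : Ω → F} (hk : Measurable k) (hX : Measurable X) (hY : Measurable Y) :
    X ⟂ᵢ[k, hk; μ.map φ] Y ↔ (X ∘ φ) ⟂ᵢ[k ∘ φ, hk.comp hφ; μ] (Y ∘ φ) := by
  have hκ : condDistrib (Y ∘ φ) (k ∘ φ) μ =ᵐ[μ.map (k ∘ φ)] condDistrib Y k (μ.map φ) :=
    (condDistrib_map hk.aemeasurable hY.aemeasurable hφ.aemeasurable).symm
  rw [condIndepFun_iff_map_eq_compProd hk hX hY (ae_eq_refl _),
    condIndepFun_iff_map_eq_compProd (hk.comp hφ) (hX.comp hφ) (hY.comp hφ) hκ,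
    Measure.map_map (by fun_prop) hφ, Measure.map_map (by fun_prop) hφ]
  rfl

end CondIndep

/-! ### Mixtures and self-couplings -/

section Mixture

variable {Ω : Type*} [MeasurableSpace Ω]

theorem tsum_two_inv_pow_succ : ∑' n : ℕ, (2⁻¹ : ℝ≥0∞) ^ (n + 1) = 1 := by
  simp only [ENNReal.tsum_geometric_add_one, ENNReal.one_sub_inv_two, inv_inv]
  exact ENNReal.inv_mul_cancel two_ne_zero ENNReal.ofNat_ne_top

/-- The mixture of a sequence of laws with the geometric weights `2⁻¹, 2⁻², …`. It dominates every
law of the sequence. -/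
def mixture (μs : ℕ → ProbabilityMeasure Ω) : ProbabilityMeasure Ω :=
  ⟨Measure.sum fun n => (2⁻¹ : ℝ≥0∞) ^ (n + 1) • (μs n : Measure Ω), ⟨by
    simp only [Measure.sum_apply _ MeasurableSet.univ, Measure.smul_apply, measure_univ,
      smul_eq_mul, mul_one, tsum_two_inv_pow_succ]⟩⟩

theorem absolutelyContinuous_mixture (μs : ℕ → ProbabilityMeasure Ω) (n : ℕ) :
    (μs n : Measure Ω) ≪ (mixture μs : Measure Ω) :=
  Measure.absolutelyContinuous_sum_right n
    (Measure.absolutelyContinuous_smul (pow_ne_zero _ (ENNReal.inv_ne_zero.mpr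
      ENNReal.ofNat_ne_top)))

theorem ae_mixture_iff {μs : ℕ → ProbabilityMeasure Ω} {p : Ω → Prop} :
    (∀ᵐ o ∂(mixture μs : Measure Ω), p o) ↔ ∀ n, ∀ᵐ o ∂(μs n : Measure Ω), p o :=
  ⟨fun h n => (absolutelyContinuous_mixture μs n).ae_le h,
    fun h => Measure.ae_sum_iff.mpr fun n => Measure.ae_smul_measure (h n) _⟩

theorem map_mixture {Ω' : Type*} [MeasurableSpace Ω'] {f : Ω → Ω'} (hf : Measurable f)
    (μs : ℕ → ProbabilityMeasure Ω) :
    (mixture μs : Measure Ω).map f =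
      Measure.sum fun n => (2⁻¹ : ℝ≥0∞) ^ (n + 1) • (μs n : Measure Ω).map f := by
  simp only [mixture, ProbabilityMeasure.coe_mk, Measure.map_sum hf.aemeasurable, Measure.map_smul]

theorem sum_two_inv_pow_succ_smul (μ : Measure Ω) :
    (Measure.sum fun n : ℕ => (2⁻¹ : ℝ≥0∞) ^ (n + 1) • μ) = μ := by
  ext s hs
  simp only [Measure.sum_apply _ hs, Measure.smul_apply, smul_eq_mul, ENNReal.tsum_mul_right,
    tsum_two_inv_pow_succ, one_mul]

end Mixture

section Support

variable {A G : Type*} [MeasurableSpace A] [TopologicalSpace G] [SecondCountableTopology G]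
  [MeasurableSpace G] [OpensMeasurableSpace G]

open TopologicalSpace

theorem ae_mem_support_compProd (ν : Measure A) [SFinite ν] (κ : Kernel A G) [IsSFiniteKernel κ] :
    ∀ᵐ q ∂(ν ⊗ₘ κ), q.2 ∈ (κ q.1).support := by
  have hsupp : {q : A × G | q.2 ∈ (κ q.1).support} =
      ⋂ U ∈ countableBasis G, {q : A × G | q.2 ∈ U → 0 < κ q.1 U} := by
    ext q
    simp only [Set.mem_ofPred_eq, (isBasis_countableBasis G).nhds_hasBasis.mem_measureSupport,
      Set.mem_iInter, and_imp]
  have hmeas : MeasurableSet {q : A × G | q.2 ∈ (κ q.1).support} := by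
    rw [hsupp]
    refine MeasurableSet.biInter (countable_countableBasis G) fun U hU => ?_
    have hU' := (isOpen_of_mem_countableBasis hU).measurableSet
    exact (measurable_snd hU').imp (measurableSet_lt measurable_const
      ((Kernel.measurable_coe κ hU').comp measurable_fst))
  rw [Measure.ae_compProd_iff hmeas]
  exact ae_of_all _ fun a => Measure.support_mem_ae

theorem measurableSet_nontrivial_support [T2Space G] (κ : Kernel A G) :
    MeasurableSet {a | (κ a).support.Nontrivial} := by
  have hsupp : {a | (κ a).support.Nontrivial} = ⋃ U ∈ countableBasis G, ⋃ V ∈ countableBasis G,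
      {a | Disjoint U V ∧ 0 < κ a U ∧ 0 < κ a V} := by
    ext a
    simp only [Set.mem_iUnion, Set.mem_ofPred_eq, exists_prop]
    constructor
    · rintro ⟨x, hx, x', hx', hne⟩
      obtain ⟨O, O', hO, hO', hxO, hxO', hdisj⟩ := t2_separation hne
      obtain ⟨U, hU, hxU, hUO⟩ := (isBasis_countableBasis G).exists_subset_of_mem_open hxO hO
      obtain ⟨V, hV, hxV, hVO⟩ := (isBasis_countableBasis G).exists_subset_of_mem_open hxO' hO'
      exact ⟨U, hU, V, hV, hdisj.mono hUO hVO,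
        (Measure.mem_support_iff_forall x).mp hx U
          ((isOpen_of_mem_countableBasis hU).mem_nhds hxU),
        (Measure.mem_support_iff_forall x').mp hx' V
          ((isOpen_of_mem_countableBasis hV).mem_nhds hxV)⟩
    · rintro ⟨U, -, V, -, hdisj, hκU, hκV⟩
      obtain ⟨x, hxU, hx⟩ := Measure.nonempty_inter_support_of_pos hκU
      obtain ⟨x', hxV, hx'⟩ := Measure.nonempty_inter_support_of_pos hκV
      exact ⟨x, hx, x', hx', hdisj.ne_of_mem hxU hxV⟩
  rw [hsupp]
  have hpos : ∀ U ∈ countableBasis G, MeasurableSet {a | 0 < κ a U} := fun U hU =>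
    measurableSet_lt measurable_const
      (Kernel.measurable_coe κ (isOpen_of_mem_countableBasis hU).measurableSet)
  exact .biUnion (countable_countableBasis G) fun U hU =>
    .biUnion (countable_countableBasis G) fun V hV => (MeasurableSet.const _).inter
      ((hpos U hU).inter (hpos V hV))

end Support

section SelfCoupling

variable {E A F : Type*} [MeasurableSpace E] [MeasurableSpace A] [MeasurableSpace F]

/-- A coupling `π(dx₁, dx₂, da)` of the law `μ(dx, da)` with itself in which both copies share the
second component. -/
structure IsSelfCoupling (μ : Measure (E × A)) (π : Measure (E × E × A)) : Prop where
  map_left : π.map (fun p => (p.1, p.2.2)) = μ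
  map_right : π.map (fun p => (p.2.1, p.2.2)) = μ

theorem map_compProd_comap_condDistrib {Ω Ω' B : Type*} [MeasurableSpace Ω] [MeasurableSpace Ω']
    [MeasurableSpace B] [StandardBorelSpace E] [Nonempty E] {μ : Measure Ω} [IsFiniteMeasure μ]
    {β : Measure Ω'} [SFinite β] {X : Ω → B} {Y : Ω → E} (hY : Measurable Y) {R : Ω' → B}
    (hR : Measurable R) (h : β.map R = μ.map X) :
    (β ⊗ₘ (condDistrib Y X μ).comap R hR).map (Prod.map R id) = μ.map fun o => (X o, Y o) := by
  rw [← compProd_map_condDistrib hY.aemeasurable, ← h]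
  ext s hs
  rw [Measure.map_apply (hR.prodMap measurable_id) hs,
    Measure.compProd_apply (hR.prodMap measurable_id hs), Measure.compProd_apply hs,
    lintegral_map (Kernel.measurable_kernel_prodMk_left hs) hR]
  rfl

variable [StandardBorelSpace E] [Nonempty E] {μ : Measure (E × A)} [IsFiniteMeasure μ] {e : E → F}
  {Ω : Type*} [MeasurableSpace Ω] {β : Measure Ω} [SFinite β] {g : Ω → A} {r : Ω → F}

theorem map_compProd_condDistrib_fst (he : Measurable e) (hgr : Measurable fun o => (g o, r o))
    (h : β.map (fun o => (g o, r o)) = μ.map fun p => (p.2, e p.1)) :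
    (β ⊗ₘ (condDistrib Prod.fst (fun p => (p.2, e p.1)) μ).comap _ hgr).map
      (fun z => (z.2, g z.1)) = μ := by
  have hmap := congrArg (Measure.map fun q : (A × F) × E => (q.2, q.1.1))
    (map_compProd_comap_condDistrib measurable_fst hgr h)
  rw [Measure.map_map (by fun_prop) (by fun_prop), Measure.map_map (by fun_prop) (by fun_prop)]
    at hmap
  exact hmap.trans Measure.map_id

theorem ae_compProd_condDistrib_fst [MeasurableEq F] (he : Measurable e)
    (hgr : Measurable fun o => (g o, r o))
    (h : β.map (fun o => (g o, r o)) = μ.map fun p => (p.2, e p.1)) :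
    ∀ᵐ z ∂(β ⊗ₘ (condDistrib Prod.fst (fun p => (p.2, e p.1)) μ).comap _ hgr), e z.2 = r z.1 := by
  have hmeas : MeasurableSet {q : (A × F) × E | e q.2 = q.1.2} :=
    _root_.measurableSet_eq_fun (by fun_prop) (by fun_prop)
  have hae : ∀ᵐ q ∂(μ.map fun p => ((p.2, e p.1), p.1)), e q.2 = q.1.2 :=
    (ae_map_iff (by fun_prop) hmeas).mpr (ae_of_all _ fun _ => rfl)
  rw [← map_compProd_comap_condDistrib measurable_fst hgr h] at hae
  exact ae_of_ae_map (by fun_prop) hae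

/-- Gluing: a coupling of the law of `(e x, a)` with itself over the component `a` lifts to a
self-coupling of the law of `(x, a)`. -/
theorem exists_isSelfCoupling_map_eq [MeasurableEq F] (he : Measurable e) {r₁ r₂ : Ω → F}
    (hg : Measurable g) (hr₁ : Measurable r₁) (hr₂ : Measurable r₂)
    (h₁ : β.map (fun o => (g o, r₁ o)) = μ.map fun p => (p.2, e p.1))
    (h₂ : β.map (fun o => (g o, r₂ o)) = μ.map fun p => (p.2, e p.1)) :
    ∃ π, IsSelfCoupling μ π ∧
      π.map (fun p => (e p.1, e p.2.1)) = β.map fun o => (r₁ o, r₂ o) := by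
  let ρ : Kernel (A × F) E := condDistrib Prod.fst (fun p : E × A => (p.2, e p.1)) μ
  let ρ₁ := ρ.comap (fun o => (g o, r₁ o)) (hg.prodMk hr₁)
  let ρ₂ := ρ.comap (fun o => (g o, r₂ o)) (hg.prodMk hr₂)
  let τ := β ⊗ₘ (ρ₁ ×ₖ ρ₂)
  have hτ₁ : τ.map (Prod.map id Prod.fst) = β ⊗ₘ ρ₁ := by
    rw [← Kernel.fst_prod ρ₁ ρ₂, Kernel.fst_eq, Measure.compProd_map measurable_fst]
  have hτ₂ : τ.map (Prod.map id Prod.snd) = β ⊗ₘ ρ₂ := by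
    rw [← Kernel.snd_prod ρ₁ ρ₂, Kernel.snd_eq, Measure.compProd_map measurable_snd]
  have he₁ : ∀ᵐ z ∂τ, e z.2.1 = r₁ z.1 :=
    ae_of_ae_map (by fun_prop) (hτ₁ ▸ ae_compProd_condDistrib_fst he (hg.prodMk hr₁) h₁)
  have he₂ : ∀ᵐ z ∂τ, e z.2.2 = r₂ z.1 :=
    ae_of_ae_map (by fun_prop) (hτ₂ ▸ ae_compProd_condDistrib_fst he (hg.prodMk hr₂) h₂)
  refine ⟨τ.map fun z => (z.2.1, z.2.2, g z.1), ⟨?_, ?_⟩, ?_⟩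
  · rw [Measure.map_map (by fun_prop) (by fun_prop)]
    have hmap := map_compProd_condDistrib_fst he (hg.prodMk hr₁) h₁
    rwa [← hτ₁, Measure.map_map (by fun_prop) (by fun_prop)] at hmap
  · rw [Measure.map_map (by fun_prop) (by fun_prop)]
    have hmap := map_compProd_condDistrib_fst he (hg.prodMk hr₂) h₂
    rwa [← hτ₂, Measure.map_map (by fun_prop) (by fun_prop)] at hmap
  · rw [Measure.map_map (by fun_prop) (by fun_prop)]
    calc τ.map (fun z => (e z.2.1, e z.2.2))
      _ = τ.map (fun z => (r₁ z.1, r₂ z.1)) :=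
          Measure.map_congr (by filter_upwards [he₁, he₂] with z hz₁ hz₂; rw [hz₁, hz₂])
      _ = (τ.map Prod.fst).map fun o => (r₁ o, r₂ o) :=
          (Measure.map_map (hr₁.prodMk hr₂) measurable_fst).symm
      _ = β.map fun o => (r₁ o, r₂ o) := congrArg _ (Measure.fst_compProd _ _)

end SelfCoupling

section Atoms

variable {E A F : Type*} [MeasurableSpace E] [MeasurableSpace A] [MeasurableSpace F]

theorem setLIntegral_condDistrib_singleton {Ω : Type*} [MeasurableSpace Ω] [StandardBorelSpace F]
    [Nonempty F] {μ : Measure Ω} [IsFiniteMeasure μ] {X : Ω → A} {Y : Ω → F} (hX : Measurable X)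
    (hY : Measurable Y) {m : A → F} (hm : Measurable m) {D : Set A} (hD : MeasurableSet D) :
    ∫⁻ a in D, condDistrib Y X μ a {m a} ∂(μ.map X) = μ {o | X o ∈ D ∧ Y o = m (X o)} := by
  have hgraph : MeasurableSet {q : A × F | q.2 = m q.1} :=
    _root_.measurableSet_eq_fun measurable_snd (hm.comp measurable_fst)
  calc ∫⁻ a in D, condDistrib Y X μ a {m a} ∂(μ.map X)
    _ = ∫⁻ a, condDistrib Y X μ a (Prod.mk a ⁻¹' (Prod.fst ⁻¹' D ∩ {q : A × F | q.2 = m q.1}))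
          ∂(μ.map X) := by
        rw [← lintegral_indicator hD]
        refine lintegral_congr fun a => ?_
        by_cases ha : a ∈ D
        · rw [Set.indicator_of_mem ha]
          exact congrArg _ (Set.ext fun _ => (and_iff_right ha).symm)
        · rw [Set.indicator_of_notMem ha]
          exact (measure_mono_null (fun _ h => ha h.1) measure_empty).symm
    _ = (μ.map fun o => (X o, Y o)) (Prod.fst ⁻¹' D ∩ {q : A × F | q.2 = m q.1}) := by
        rw [← compProd_map_condDistrib hY.aemeasurable,
          Measure.compProd_apply ((measurable_fst hD).inter hgraph)]
    _ = μ {o | X o ∈ D ∧ Y o = m (X o)} :=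
        Measure.map_apply (hX.prodMk hY) ((measurable_fst hD).inter hgraph)

variable {μ : Measure (E × A)} {π : Measure (E × E × A)}

theorem IsSelfCoupling.measure_add_measure_le [MeasurableEq F] (hπ : IsSelfCoupling μ π)
    {e : E → F} (he : Measurable e) {m : A → F} (hm : Measurable m) {D : Set A}
    (hD : MeasurableSet D) :
    μ {p | p.2 ∈ D ∧ e p.1 = m p.2} + μ {p | p.2 ∈ D ∧ e p.1 = m p.2} ≤
      μ.map Prod.snd D + π {p | e p.1 = e p.2.1} := by
  have hS : MeasurableSet {p : E × A | p.2 ∈ D ∧ e p.1 = m p.2} :=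
    (measurable_snd hD).inter (_root_.measurableSet_eq_fun (by fun_prop) (by fun_prop))
  have hleft := Measure.map_apply (μ := π) (f := fun p => (p.1, p.2.2)) (by fun_prop) hS
  have hright := Measure.map_apply (μ := π) (f := fun p => (p.2.1, p.2.2)) (by fun_prop) hS
  have hD' := Measure.map_apply (μ := π) (f := fun p => (p.1, p.2.2)) (by fun_prop)
    (measurable_snd hD)
  rw [hπ.map_left] at hleft hD'
  rw [hπ.map_right] at hright
  rw [Measure.map_apply measurable_snd hD, hD']
  nth_rw 1 [hleft]
  rw [hright, ← measure_union_add_inter _ (Measurable.prodMk (by fun_prop) (by fun_prop) hS)]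
  exact add_le_add (measure_mono fun p hp => hp.elim And.left And.left)
    (measure_mono fun p hp => hp.1.2.trans hp.2.2.symm)

theorem ae_condDistrib_singleton_le_half [StandardBorelSpace F] [Nonempty F] [IsFiniteMeasure μ]
    {e : E → F} (he : Measurable e) {m : A → F} (hm : Measurable m)
    (H : ∀ γ : ℝ≥0∞, 0 < γ → ∃ π, IsSelfCoupling μ π ∧ π {p | e p.1 = e p.2.1} ≤ γ) :
    ∀ᵐ a ∂(μ.map Prod.snd), condDistrib (e ∘ Prod.fst) Prod.snd μ a {m a} ≤ 1 / 2 := by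
  refine ae_le_of_forall_setLIntegral_le_of_sigmaFinite
    (Kernel.measurable_kernel_prodMk_left
      (_root_.measurableSet_eq_fun measurable_snd (hm.comp measurable_fst))) fun D hD _ => ?_
  rw [setLIntegral_condDistrib_singleton measurable_snd (he.comp measurable_fst) hm hD,
    setLIntegral_const, one_div, mul_comm, ← div_eq_mul_inv,
    ENNReal.le_div_iff_mul_le (by simp) (by simp), mul_two]
  refine ENNReal.le_of_forall_pos_le_add fun γ hγ _ => ?_
  obtain ⟨π, hπ, hle⟩ := H γ (ENNReal.coe_pos.mpr hγ)
  exact (hπ.measure_add_measure_le he hm hD).trans (add_le_add_right hle _)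

end Atoms

section Quantile

/-- The uniform distribution on `(0,1)`. -/
def uniformLaw : Measure ℝ := volume.restrict (Set.Ioo 0 1)

instance instIsProbabilityMeasureUniformLaw : IsProbabilityMeasure uniformLaw :=
  ⟨by simp [uniformLaw]⟩

open Classical in
/-- The quantile function of a probability measure on the line, with junk value `0` outside
`(0,1)`. -/
def quantile (ν : Measure ℝ) (r : ℝ) : ℝ :=
  if r ∈ Set.Ioo (0 : ℝ) 1 then sInf {x | r ≤ cdf ν x} else 0

theorem quantile_le_iff (ν : Measure ℝ) {r : ℝ} (hr : r ∈ Set.Ioo (0 : ℝ) 1) (x : ℝ) :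
    quantile ν r ≤ x ↔ r ≤ cdf ν x := by
  rw [quantile, if_pos hr]
  have hne : {x | r ≤ cdf ν x}.Nonempty :=
    ((tendsto_cdf_atTop ν).eventually_const_le hr.2).exists
  have hbdd : BddBelow {x | r ≤ cdf ν x} := by
    obtain ⟨b, hb⟩ := ((tendsto_cdf_atBot ν).eventually_lt_const hr.1).exists
    exact ⟨b, fun x hx => le_of_lt ((monotone_cdf ν).reflect_lt (hb.trans_le hx))⟩
  refine ⟨fun h => ?_, fun h => csInf_le hbdd h⟩
  refine le_trans ?_ (monotone_cdf ν h)
  have hc : Tendsto (cdf ν) (𝓝[>] (sInf {x | r ≤ cdf ν x}))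
      (𝓝 (cdf ν (sInf {x | r ≤ cdf ν x}))) :=
    ((cdf ν).right_continuous _).mono Set.Ioi_subset_Ici_self
  refine ge_of_tendsto hc ?_
  filter_upwards [self_mem_nhdsWithin] with z hz
  obtain ⟨w, hw, hwz⟩ := exists_lt_of_csInf_lt hne hz
  exact hw.trans (monotone_cdf ν hwz.le)

theorem monotoneOn_quantile (ν : Measure ℝ) : MonotoneOn (quantile ν) (Set.Ioo 0 1) :=
  fun _ hr _ hs h => (quantile_le_iff ν hr _).mpr (h.trans ((quantile_le_iff ν hs _).mp le_rfl))

theorem measurable_quantile_kernel {A : Type*} [MeasurableSpace A] (κ : Kernel A ℝ)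
    [IsMarkovKernel κ] : Measurable fun p : A × ℝ => quantile (κ p.1) p.2 := by
  refine measurable_of_Iic fun x => ?_
  have hpre : (fun p : A × ℝ => quantile (κ p.1) p.2) ⁻¹' Set.Iic x =
      ({p | p.2 ∈ Set.Ioo (0 : ℝ) 1} ∩ {p | p.2 ≤ (κ p.1).real (Set.Iic x)}) ∪
      ({p | p.2 ∈ Set.Ioo (0 : ℝ) 1}ᶜ ∩ {_p | (0 : ℝ) ≤ x}) := by
    ext ⟨a, r⟩
    by_cases hr : r ∈ Set.Ioo (0 : ℝ) 1
    · have h := quantile_le_iff (κ a) hr x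
      rw [cdf_eq_real] at h
      simp only [Set.mem_preimage, Set.mem_Iic, h, Set.mem_union, Set.mem_inter_iff,
        Set.mem_compl_iff, Set.mem_ofPred_eq, hr, true_and, not_true_eq_false, false_and, or_false]
    · simp only [Set.mem_preimage, Set.mem_Iic, quantile, Set.mem_union, Set.mem_inter_iff,
        Set.mem_compl_iff, Set.mem_ofPred_eq, hr, false_and, not_false_eq_true, true_and, false_or,
        if_false]
  rw [hpre]
  have hI : MeasurableSet {p : A × ℝ | p.2 ∈ Set.Ioo (0 : ℝ) 1} := measurable_snd measurableSet_Ioo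
  refine (hI.inter (measurableSet_le measurable_snd ?_)).union (hI.compl.inter (.const _))
  exact ((Kernel.measurable_coe κ measurableSet_Iic).comp measurable_fst).ennreal_toReal

theorem measurable_quantile (ν : Measure ℝ) [IsProbabilityMeasure ν] : Measurable (quantile ν) :=
  (measurable_quantile_kernel (Kernel.const Unit ν)).comp (measurable_prodMk_left (x := ()))

theorem map_quantile (ν : Measure ℝ) [IsProbabilityMeasure ν] :
    uniformLaw.map (quantile ν) = ν := by
  have _ : IsProbabilityMeasure (uniformLaw.map (quantile ν)) :=
    Measure.isProbabilityMeasure_map (measurable_quantile ν).aemeasurable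
  refine Measure.ext_of_Iic _ _ fun x => ?_
  rw [Measure.map_apply (measurable_quantile ν) measurableSet_Iic, uniformLaw,
    Measure.restrict_apply (measurable_quantile ν measurableSet_Iic)]
  have hpre : quantile ν ⁻¹' Set.Iic x ∩ Set.Ioo 0 1 = Set.Iic (cdf ν x) ∩ Set.Ioo 0 1 := by
    ext r
    simp only [Set.mem_inter_iff, Set.mem_preimage, Set.mem_Iic, and_congr_left_iff]
    exact fun hr => quantile_le_iff ν hr x
  rw [hpre, ← Measure.restrict_apply measurableSet_Iic, Measure.restrict_congr_set Ioo_ae_eq_Ioc,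
    Measure.restrict_apply measurableSet_Iic, Set.inter_comm, Set.Ioc_inter_Iic,
    min_eq_right (cdf_le_one ν x), Real.volume_Ioc, sub_zero, ofReal_cdf]

theorem eq_leftLim_of_quantile_eq (ν : Measure ℝ) [IsProbabilityMeasure ν]
    (hν : ν {quantile ν (1 / 2)} ≤ 1 / 2) {r : ℝ} (hr₀ : 0 < r) (hr₁ : r < 1 / 2)
    (h : quantile ν r = quantile ν (r + 1 / 2)) :
    r = Function.leftLim (cdf ν) (quantile ν (1 / 2)) := by
  set m := quantile ν (1 / 2)
  have hr : r ∈ Set.Ioo (0 : ℝ) 1 := ⟨hr₀, by linarith⟩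
  have hr' : r + 1 / 2 ∈ Set.Ioo (0 : ℝ) 1 := ⟨by linarith, by linarith⟩
  have hhalf : (1 / 2 : ℝ) ∈ Set.Ioo (0 : ℝ) 1 := ⟨by norm_num, by norm_num⟩
  have hm : quantile ν r = m := le_antisymm (monotoneOn_quantile ν hr hhalf hr₁.le)
    (h ▸ monotoneOn_quantile ν hhalf hr' (by linarith))
  have hupper : r + 1 / 2 ≤ cdf ν m := (quantile_le_iff ν hr' m).mp (by rw [← h, hm])
  have hlower : Function.leftLim (cdf ν) m ≤ r := by
    refine le_of_tendsto ((monotone_cdf ν).tendsto_leftLim m) ?_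
    filter_upwards [self_mem_nhdsWithin] with x hx
    by_contra! hlt
    exact (Set.mem_Iio.mp hx).not_ge (hm ▸ (quantile_le_iff ν hr x).mpr hlt.le)
  have hjump : cdf ν m - Function.leftLim (cdf ν) m ≤ 1 / 2 := by
    have hatom := (cdf ν).measure_singleton m
    rw [measure_cdf] at hatom
    rw [hatom, ENNReal.ofReal_le_iff_le_toReal (by simp)] at hν
    simpa using hν
  linarith

/-- The rotation of `(0,1)` by `1/2`. -/
def halfShift (r : ℝ) : ℝ := if r < 1 / 2 then r + 1 / 2 else r - 1 / 2

theorem measurable_halfShift : Measurable halfShift :=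
  Measurable.ite measurableSet_Iio (by fun_prop) (by fun_prop)

theorem map_add_const_restrict_Ico (a b c : ℝ) :
    (volume.restrict (Set.Ico a b)).map (· + c) = volume.restrict (Set.Ico (a + c) (b + c)) := by
  have h := ((measurePreserving_add_right volume c).restrict_preimage
    (measurableSet_Ico (a := a + c) (b := b + c))).map_eq
  rwa [Set.preimage_add_const_Ico, add_sub_cancel_right, add_sub_cancel_right] at h

theorem map_halfShift : uniformLaw.map halfShift = uniformLaw := by
  have hsplit : uniformLaw = volume.restrict (Set.Ico (0 : ℝ) (1 / 2)) +
      volume.restrict (Set.Ico (1 / 2 : ℝ) 1) := by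
    rw [uniformLaw, Measure.restrict_congr_set Ioo_ae_eq_Ico,
      ← Set.Ico_union_Ico_eq_Ico (b := (1 / 2 : ℝ)) (by norm_num) (by norm_num),
      Measure.restrict_union (Set.Ico_disjoint_Ico_same) measurableSet_Ico]
  have hleft : (volume.restrict (Set.Ico (0 : ℝ) (1 / 2))).map halfShift =
      volume.restrict (Set.Ico (1 / 2 : ℝ) 1) := by
    have h := map_add_const_restrict_Ico 0 (1 / 2) (1 / 2)
    rw [zero_add, add_halves] at h
    rw [← h]
    refine Measure.map_congr ?_
    filter_upwards [ae_restrict_mem measurableSet_Ico] with r hr using if_pos hr.2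
  have hright : (volume.restrict (Set.Ico (1 / 2 : ℝ) 1)).map halfShift =
      volume.restrict (Set.Ico (0 : ℝ) (1 / 2)) := by
    have h := map_add_const_restrict_Ico (1 / 2) 1 (-(1 / 2))
    rw [add_neg_cancel, ← sub_eq_add_neg, sub_half] at h
    rw [← h]
    refine Measure.map_congr ?_
    filter_upwards [ae_restrict_mem measurableSet_Ico] with r hr
    exact (if_neg hr.1.not_gt).trans (sub_eq_add_neg r _)
  rw [hsplit, Measure.map_add _ _ measurable_halfShift, hleft, hright, add_comm]

theorem ae_quantile_ne (ν : Measure ℝ) [IsProbabilityMeasure ν]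
    (hν : ν {quantile ν (1 / 2)} ≤ 1 / 2) :
    ∀ᵐ r ∂uniformLaw, quantile ν r ≠ quantile ν (halfShift r) := by
  set a := Function.leftLim (cdf ν) (quantile ν (1 / 2))
  have hfin : ∀ᵐ r : ℝ, r ∉ ({a, a + 1 / 2, 1 / 2} : Set ℝ) :=
    measure_eq_zero_iff_ae_notMem.mp (Set.Finite.measure_zero (Set.toFinite _) _)
  rw [uniformLaw]
  filter_upwards [ae_restrict_of_ae hfin, ae_restrict_mem measurableSet_Ioo] with r hr hr₀₁ heq
  simp only [Set.mem_insert_iff, Set.mem_singleton_iff, not_or] at hr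
  rcases lt_or_ge r (1 / 2) with h | h
  · rw [halfShift, if_pos h] at heq
    exact hr.1 (eq_leftLim_of_quantile_eq ν hν hr₀₁.1 h heq)
  · rw [halfShift, if_neg (not_lt.mpr h)] at heq
    have h' : 1 / 2 < r := h.lt_of_ne' hr.2.2
    refine hr.2.1 (sub_eq_iff_eq_add.mp (eq_leftLim_of_quantile_eq ν hν (by linarith)
      (by linarith [hr₀₁.2]) ?_))
    rw [sub_add_cancel, heq]

end Quantile

section NullCoupling

variable {E A : Type*} [MeasurableSpace E] [StandardBorelSpace E] [Nonempty E] [MeasurableSpace A]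
  {μ : Measure (E × A)} [IsProbabilityMeasure μ]

theorem map_prodMk_quantile (ν : Measure A) [SFinite ν] (κ : Kernel A ℝ) [IsMarkovKernel κ] :
    (ν.prod uniformLaw).map (fun b => (b.1, quantile (κ b.1) b.2)) = ν ⊗ₘ κ := by
  have hq : Measurable fun b : A × ℝ => (b.1, quantile (κ b.1) b.2) :=
    measurable_fst.prodMk (measurable_quantile_kernel κ)
  ext s hs
  rw [Measure.map_apply hq hs, Measure.prod_apply (hq hs), Measure.compProd_apply hs]
  refine lintegral_congr fun a => ?_
  conv_rhs => rw [← map_quantile (κ a),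
    Measure.map_apply (measurable_quantile _) (measurable_prodMk_left hs)]
  rfl

theorem map_prodMk_quantile_halfShift (ν : Measure A) [SFinite ν] (κ : Kernel A ℝ)
    [IsMarkovKernel κ] :
    (ν.prod uniformLaw).map (fun b => (b.1, quantile (κ b.1) (halfShift b.2))) = ν ⊗ₘ κ := by
  have hshift : (ν.prod uniformLaw).map (Prod.map id halfShift) = ν.prod uniformLaw := by
    rw [← Measure.map_prod_map _ _ measurable_id measurable_halfShift, Measure.map_id,
      map_halfShift]
  rw [← map_prodMk_quantile ν κ]
  conv_rhs => rw [← hshift]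
  exact (Measure.map_map (measurable_fst.prodMk (measurable_quantile_kernel κ))
    (measurable_id.prodMap measurable_halfShift)).symm

/-- Two conditional quantiles at levels differing by `1/2` have the same conditional law, and they
are distinct because no conditional law has an atom of mass above `1/2`. -/
theorem exists_isSelfCoupling_real_eq_zero {e : E → ℝ} (he : Measurable e)
    (H : ∀ γ : ℝ≥0∞, 0 < γ → ∃ π, IsSelfCoupling μ π ∧ π {p | e p.1 = e p.2.1} ≤ γ) :
    ∃ π, IsSelfCoupling μ π ∧ π {p | e p.1 = e p.2.1} = 0 := by
  let ν := μ.map Prod.snd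
  let κ := condDistrib (e ∘ Prod.fst) Prod.snd μ
  have hμ : ν ⊗ₘ κ = μ.map fun p => (p.2, e p.1) :=
    compProd_map_condDistrib (he.comp measurable_fst).aemeasurable
  have hq : Measurable fun b : A × ℝ => quantile (κ b.1) b.2 := measurable_quantile_kernel κ
  have hq' : Measurable fun b : A × ℝ => quantile (κ b.1) (halfShift b.2) :=
    hq.comp (measurable_id.prodMap measurable_halfShift)
  obtain ⟨π, hπ, hmap⟩ := exists_isSelfCoupling_map_eq (β := ν.prod uniformLaw) he measurable_fst
    hq hq' ((map_prodMk_quantile ν κ).trans hμ) ((map_prodMk_quantile_halfShift ν κ).trans hμ)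
  refine ⟨π, hπ, ?_⟩
  have hatom : ∀ᵐ a ∂ν, κ a {quantile (κ a) (1 / 2)} ≤ 1 / 2 :=
    ae_condDistrib_singleton_le_half he (hq.comp measurable_prodMk_right) H
  have hne : ∀ᵐ b ∂(ν.prod uniformLaw), quantile (κ b.1) b.2 ≠ quantile (κ b.1) (halfShift b.2) :=
    (Measure.ae_prod_iff_ae_ae (_root_.measurableSet_eq_fun hq hq').compl).mpr
      (hatom.mono fun a ha => ae_quantile_ne (κ a) ha)
  have hdiag : MeasurableSet {x : ℝ × ℝ | x.1 = x.2} := measurableSet_diagonal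
  calc π {p | e p.1 = e p.2.1}
    _ = (π.map fun p => (e p.1, e p.2.1)) {x | x.1 = x.2} :=
        (Measure.map_apply ((he.comp measurable_fst).prodMk
          (he.comp (measurable_fst.comp measurable_snd))) hdiag).symm
    _ = (ν.prod uniformLaw) {b | quantile (κ b.1) b.2 = quantile (κ b.1) (halfShift b.2)} := by
        rw [hmap, Measure.map_apply (hq.prodMk hq') hdiag]
        rfl
    _ = 0 := measure_eq_zero_iff_ae_notMem.mpr hne

theorem exists_isSelfCoupling_eq_zero {G : Type*} [MeasurableSpace G] [StandardBorelSpace G]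
    {e : E → G} (he : Measurable e)
    (H : ∀ γ : ℝ≥0∞, 0 < γ → ∃ π, IsSelfCoupling μ π ∧ π {p | e p.1 = e p.2.1} ≤ γ) :
    ∃ π, IsSelfCoupling μ π ∧ π {p | e p.1 = e p.2.1} = 0 := by
  have hemb := measurableEmbedding_embeddingReal G
  have hset : {p : E × E × A | (embeddingReal G ∘ e) p.1 = (embeddingReal G ∘ e) p.2.1} =
      {p | e p.1 = e p.2.1} := Set.ext fun p => hemb.injective.eq_iff
  rw [← hset] at H ⊢
  exact exists_isSelfCoupling_real_eq_zero (hemb.measurable.comp he) H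

end NullCoupling

/-! ### Carathéodory solutions and their drift parts -/

variable {d : ℕ}

namespace VelocityField

theorem continuousOn (u : VelocityField d) :
    ContinuousOn (fun p : ℝ × Space d => u p.1 p.2) (Set.Ioc 0 1 ×ˢ Set.univ) :=
  u.smooth.continuousOn

theorem continuous_apply (u : VelocityField d) (t : ℝ) : Continuous (u t) := by
  by_cases ht : t ∈ Set.Ioc (0 : ℝ) 1
  · exact u.continuousOn.comp_continuous (f := fun x : Space d => (t, x)) (by fun_prop)
      fun _ => ⟨ht, trivial⟩
  · rw [u.eq_zero t ht]
    exact continuous_const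

theorem measurable_apply (t : ℝ) (x : Space d) : Measurable fun u : VelocityField d => u t x :=
  have h : Measurable (VelocityField.toFun (d := d)) := comap_measurable _
  (measurable_pi_apply x).comp ((measurable_pi_apply t).comp h)

theorem measurable_uncurry :
    Measurable fun p : VelocityField d × ℝ × Space d => p.1 p.2.1 p.2.2 := by
  set S : Set (VelocityField d × ℝ × Space d) := {p | p.2.1 ∈ Set.Ioc (0 : ℝ) 1}
  have hS : MeasurableSet S := measurableSet_Ioc.preimage (by fun_prop)
  refine measurable_of_restrict_of_restrict_compl hS ?_ ?_
  · have huncurry : Measurable (Function.uncurry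
        fun (q : Set.Ioc (0 : ℝ) 1 × Space d) (u : VelocityField d) => u q.1 q.2) :=
      measurable_uncurry_of_continuous_of_measurable
        (fun u => u.continuousOn.comp_continuous
          (f := fun q : Set.Ioc (0 : ℝ) 1 × Space d => ((q.1 : ℝ), q.2)) (by fun_prop)
          fun q => ⟨q.1.2, trivial⟩)
        fun q => measurable_apply _ _
    exact huncurry.comp (f := fun p : S => ((⟨p.1.2.1, p.2⟩, p.1.2.2), p.1.1)) (by fun_prop)
  · have hzero : Sᶜ.domRestrict (fun p : VelocityField d × ℝ × Space d => p.1 p.2.1 p.2.2) = 0 :=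
      funext fun p => congrFun (p.1.1.eq_zero p.1.2.1 p.2) _
    rw [hzero]
    exact measurable_const

/-- The supremum norm `sup_x |u(t,x)|` at time `t`. -/
def supNorm (u : VelocityField d) (t : ℝ) : ℝ≥0∞ := ⨆ x : Space d, ‖u t x‖ₑ

theorem measurable_supNorm (u : VelocityField d) : Measurable u.supNorm := by
  obtain ⟨D, hD, hdense⟩ := TopologicalSpace.exists_countable_dense (Space d)
  have : Countable D := hD.to_subtype
  have hsup (t : ℝ) : u.supNorm t = ⨆ x : D, ‖u t x‖ₑ :=
    (hdense.ciSup' (u.continuous_apply t).enorm).symm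
  have heval (x : Space d) : Measurable fun t => ‖u t x‖ₑ :=
    (measurable_uncurry.comp (f := fun t : ℝ => (u, t, x)) (by fun_prop)).enorm
  rw [funext hsup]
  exact .iSup fun x => heval x

theorem lintegral_supNorm_lt_top (u : VelocityField d) : ∫⁻ t, u.supNorm t < ⊤ := by
  have hsupp : Function.support u.supNorm ⊆ Set.Ioc 0 1 := fun t ht => by
    by_contra h
    simp [supNorm, u.eq_zero t h] at ht
  rw [← setLIntegral_eq_of_support_subset hsupp]
  exact u.integrable

/-- The supremum norm as a real number (it is infinite, with junk value `0` here, only for a null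
set of times). -/
def bound (u : VelocityField d) (t : ℝ) : ℝ := (u.supNorm t).toReal

theorem integrable_bound (u : VelocityField d) : Integrable u.bound :=
  integrable_toReal_of_lintegral_ne_top u.measurable_supNorm.aemeasurable
    u.lintegral_supNorm_lt_top.ne

theorem ae_norm_le_bound (u : VelocityField d) : ∀ᵐ t : ℝ, ∀ x, ‖u t x‖ ≤ u.bound t := by
  filter_upwards [ae_lt_top u.measurable_supNorm u.lintegral_supNorm_lt_top.ne] with t ht x
  rw [bound, ← toReal_enorm]
  exact ENNReal.toReal_mono ht.ne (le_iSup (fun x => ‖u t x‖ₑ) x)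

/-- The primitive `t ↦ ∫₀ᵗ sup_x |u(r,x)| dr`, a common modulus of continuity for the drift part
of all solutions. -/
def primitiveBound (u : VelocityField d) : C(I, ℝ) where
  toFun t := ∫ r in (0 : ℝ)..t, u.bound r
  continuous_toFun := (intervalIntegral.continuous_primitive
    (fun _ _ => u.integrable_bound.intervalIntegrable) 0).comp continuous_subtype_val

theorem integral_bound (u : VelocityField d) (t t' : I) :
    ∫ r in (t : ℝ)..t', u.bound r = u.primitiveBound t' - u.primitiveBound t :=
  (intervalIntegral.integral_interval_sub_left u.integrable_bound.intervalIntegrable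
    u.integrable_bound.intervalIntegrable).symm

theorem monotone_primitiveBound (u : VelocityField d) : Monotone u.primitiveBound := by
  intro t t' h
  rw [← sub_nonneg, ← integral_bound]
  exact intervalIntegral.integral_nonneg h fun _ _ => ENNReal.toReal_nonneg

theorem exists_lipschitz (u : VelocityField d) {s : I} (hs : 0 < s) (R : ℝ) :
    ∃ L : ℝ, 0 ≤ L ∧ ∀ r ∈ Set.Icc (s : ℝ) 1, ∀ z ∈ Metric.closedBall (0 : Space d) R,
      ∀ z' ∈ Metric.closedBall (0 : Space d) R, ‖u r z - u r z'‖ ≤ L * ‖z - z'‖ := by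
  have hlocal : LocallyLipschitzOn (Set.Ioc 0 1 ×ˢ Set.univ)
      (fun p : ℝ × Space d => u p.1 p.2) := fun p hp =>
    ((u.smooth p hp).of_le (by exact_mod_cast le_top)).exists_lipschitzOnWith
      ((convex_Ioc 0 1).prod convex_univ)
  have hsub : Set.Icc (s : ℝ) 1 ×ˢ Metric.closedBall (0 : Space d) R ⊆ Set.Ioc 0 1 ×ˢ Set.univ :=
    Set.prod_mono (Set.Icc_subset_Ioc_iff s.2.2 |>.mpr ⟨hs, le_rfl⟩) (Set.subset_univ _)
  obtain ⟨L, hL⟩ := (hlocal.mono hsub).exists_lipschitzOnWith_of_compact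
    (isCompact_Icc.prod (isCompact_closedBall 0 R))
  refine ⟨L, L.2, fun r hr z hz z' hz' => ?_⟩
  simpa [dist_eq_norm, Prod.dist_eq] using hL.dist_le_mul (r, z) ⟨hr, hz⟩ (r, z') ⟨hr, hz'⟩

end VelocityField

theorem continuous_uncurry_at_ :
    Continuous fun p : PathSpace d × ℝ => at_ p.1 p.2 := by
  unfold at_
  fun_prop

theorem at_eq {r : ℝ} (hr : r ∈ I) (X : PathSpace d) : at_ X r = X ⟨r, hr⟩ :=
  congrArg X (Set.projIcc_of_mem _ hr)

theorem measurable_velocity_at_ {Ω : Type*} [MeasurableSpace Ω] {u : Ω → VelocityField d}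
    {X : Ω → PathSpace d} (hu : Measurable u) (hX : Measurable X) :
    Measurable fun p : Ω × ℝ => u p.1 p.2 (at_ (X p.1) p.2) :=
  VelocityField.measurable_uncurry.comp ((hu.comp measurable_fst).prodMk (measurable_snd.prodMk
    (continuous_uncurry_at_.measurable.comp ((hX.comp measurable_fst).prodMk measurable_snd))))

theorem measurable_velocity_along (u : VelocityField d) (X : PathSpace d) :
    Measurable fun r => u r (at_ X r) :=
  (measurable_velocity_at_ (Ω := Unit) measurable_const measurable_const).comp
    (measurable_prodMk_left (x := ()))

theorem integrable_velocity_along (u : VelocityField d) (X : PathSpace d) :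
    Integrable fun r => u r (at_ X r) := by
  refine u.integrable_bound.mono' (measurable_velocity_along u X).aestronglyMeasurable ?_
  filter_upwards [u.ae_norm_le_bound] with r hr using hr _

/-- The drift part `t ↦ ∫ₛᵗ u(r, X_r) dr` of the equation started at time `s`, extended by `0` to
the times before `s`. -/
def drift (u : VelocityField d) (s : I) (X : PathSpace d) : PathSpace d where
  toFun t := ∫ r in (s : ℝ)..(s ⊔ t : I), u r (at_ X r)
  continuous_toFun := (intervalIntegral.continuous_primitive
    (fun _ _ => (integrable_velocity_along u X).intervalIntegrable) (s : ℝ)).comp (by fun_prop)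

theorem drift_apply (u : VelocityField d) (s : I) (X : PathSpace d) (t : I) :
    drift u s X t = ∫ r in (s : ℝ)..(s ⊔ t : I), u r (at_ X r) := rfl

theorem drift_apply_of_le (u : VelocityField d) {s t : I} (h : t ≤ s) (X : PathSpace d) :
    drift u s X t = 0 := by
  rw [drift_apply, sup_of_le_left h, intervalIntegral.integral_same]

theorem dist_drift_le (u : VelocityField d) (s : I) (X : PathSpace d) (t t' : I) :
    dist (drift u s X t) (drift u s X t') ≤ |u.primitiveBound t - u.primitiveBound t'| := by
  wlog h : t ≤ t' generalizing t t'
  · rw [dist_comm, abs_sub_comm]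
    exact this t' t (le_of_not_ge h)
  have hinterval {a b : ℝ} : IntervalIntegrable (fun r => u r (at_ X r)) volume a b :=
    (integrable_velocity_along u X).intervalIntegrable
  calc dist (drift u s X t) (drift u s X t')
      = ‖∫ r in ((s ⊔ t : I) : ℝ)..(s ⊔ t' : I), u r (at_ X r)‖ := by
        rw [dist_comm, dist_eq_norm, drift_apply, drift_apply,
          intervalIntegral.integral_interval_sub_left hinterval hinterval]
    _ ≤ ∫ r in ((s ⊔ t : I) : ℝ)..(s ⊔ t' : I), u.bound r := by
        refine intervalIntegral.norm_integral_le_of_norm_le (sup_le_sup_left h s) ?_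
          u.integrable_bound.intervalIntegrable
        filter_upwards [u.ae_norm_le_bound] with r hr _ using hr _
    _ ≤ u.primitiveBound t' - u.primitiveBound t := by
        have hmono := u.monotone_primitiveBound
        rw [u.integral_bound]
        rcases le_total s t with hs | hs
        · rw [sup_of_le_right hs, sup_of_le_right (hs.trans h)]
        · rcases le_total s t' with hs' | hs'
          · rw [sup_of_le_left hs, sup_of_le_right hs']
            linarith [hmono hs]
          · rw [sup_of_le_left hs, sup_of_le_left hs', sub_self]
            exact sub_nonneg.mpr (hmono h)
    _ ≤ |u.primitiveBound t - u.primitiveBound t'| := by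
        rw [abs_sub_comm]
        exact le_abs_self _

theorem norm_drift_apply_le (u : VelocityField d) (s : I) (X : PathSpace d) (t : I) :
    ‖drift u s X t‖ ≤ ‖u.primitiveBound‖ := by
  have h0 : u.primitiveBound 0 = 0 := intervalIntegral.integral_same
  have := dist_drift_le u s X t 0
  rw [drift_apply_of_le u (unitInterval.nonneg' : 0 ≤ s), dist_zero_right, h0, sub_zero] at this
  exact this.trans (u.primitiveBound.norm_coe_le_norm t)

theorem measurable_drift {Ω : Type*} [MeasurableSpace Ω] {u : Ω → VelocityField d}
    {X : Ω → PathSpace d} (hu : Measurable u) (hX : Measurable X) (s : I) :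
    Measurable fun o => drift (u o) s (X o) := by
  refine measurable_of_forall_eval fun t => ?_
  have hst : (s : ℝ) ≤ (s ⊔ t : I) := le_sup_left
  simp only [drift_apply, intervalIntegral.integral_of_le hst]
  exact (measurable_velocity_at_ hu hX).stronglyMeasurable.integral_prod_right'.measurable

theorem restr_eq_restr_iff {t : I} {X X' : PathSpace d} :
    restr t X = restr t X' ↔ ∀ r ≤ t, X r = X' r := by
  rw [DFunLike.ext_iff]
  exact Subtype.forall

theorem restr_drift_congr (u : VelocityField d) {s t : I} (hst : s ≤ t) {X X' : PathSpace d}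
    (hX : restr t X = restr t X') : restr t (drift u s X) = restr t (drift u s X') := by
  rw [restr_eq_restr_iff] at hX ⊢
  intro r hr
  refine intervalIntegral.integral_congr fun q hq => ?_
  rw [Set.uIcc_of_le (show (s : ℝ) ≤ (s ⊔ r : I) from le_sup_left)] at hq
  have hqI : q ∈ I := ⟨s.2.1.trans hq.1, hq.2.trans (s ⊔ r).2.2⟩
  simp only [at_eq hqI, hX ⟨q, hqI⟩ (hq.2.trans (sup_le hst hr))]

/-- The path `x + A_t + W_{s ∨ t} - W_s` with drift part `A` and noise `W`, started from `x` at
time `s`. -/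
def pathOfDrift (s : I) (x : Space d) (A W : PathSpace d) : PathSpace d where
  toFun t := x + A t + W (s ⊔ t) - W s
  continuous_toFun := by fun_prop

theorem pathOfDrift_apply (s : I) (x : Space d) (A W : PathSpace d) (t : I) :
    pathOfDrift s x A W t = x + A t + W (s ⊔ t) - W s := rfl

theorem continuous_pathOfDrift :
    Continuous fun p : I × Space d × PathSpace d × PathSpace d =>
      pathOfDrift p.1 p.2.1 p.2.2.1 p.2.2.2 := by
  refine ContinuousMap.continuous_of_continuous_uncurry _ ?_
  simp only [Function.uncurry_def, pathOfDrift_apply]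
  fun_prop

/-- The Picard map, whose fixed points are the solutions started from `x` at time `s`. -/
def picardMap (s : I) (x : Space d) (u : VelocityField d) (W X : PathSpace d) : PathSpace d :=
  pathOfDrift s x (drift u s X) W

theorem isSolutionFrom_iff {s : I} {x : Space d} {u : VelocityField d} {W X : PathSpace d} :
    IsSolutionFrom u s x W X ↔ picardMap s x u W X = X := by
  refine ⟨fun ⟨hbefore, hafter⟩ => ?_, fun h => ⟨fun t ht => ?_, fun t ht => ?_⟩⟩
  · ext1 t
    rw [picardMap, pathOfDrift_apply]
    rcases le_total t s with ht | ht
    · rw [hbefore t ht, drift_apply_of_le u ht, sup_of_le_left ht, add_zero, add_sub_cancel_right]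
    · rw [hafter t ht, drift_apply, sup_of_le_right ht]
  · rw [← h, picardMap, pathOfDrift_apply, drift_apply_of_le u ht, sup_of_le_left ht, add_zero,
      add_sub_cancel_right]
  · conv_lhs => rw [← h, picardMap, pathOfDrift_apply, drift_apply, sup_of_le_right ht]

theorem picardMap_mem_closedBall (s : I) (x : Space d) (u : VelocityField d) (W X : PathSpace d) :
    picardMap s x u W X ∈
      Metric.closedBall (0 : PathSpace d) (‖x‖ + ‖u.primitiveBound‖ + ‖W‖ + ‖W‖) := by
  rw [mem_closedBall_zero_iff, ContinuousMap.norm_le _ (by positivity)]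
  intro t
  calc ‖x + drift u s X t + W (s ⊔ t) - W s‖
      ≤ ‖x‖ + ‖drift u s X t‖ + ‖W (s ⊔ t)‖ + ‖W s‖ :=
        (norm_sub_le _ _).trans (add_le_add_left norm_add₃_le _)
    _ ≤ ‖x‖ + ‖u.primitiveBound‖ + ‖W‖ + ‖W‖ := by
        gcongr
        exacts [norm_drift_apply_le u s X t, W.norm_coe_le_norm _, W.norm_coe_le_norm _]

theorem dist_picardMap_apply (s : I) (x : Space d) (u : VelocityField d) (W X Y : PathSpace d)
    (t : I) :
    dist (picardMap s x u W X t) (picardMap s x u W Y t) =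
      dist (drift u s X t) (drift u s Y t) := by
  simp only [picardMap, pathOfDrift_apply, dist_sub_right, dist_add_right, dist_add_left]

theorem integral_mul_pow_div_factorial (C L a b : ℝ) (n : ℕ) :
    ∫ r in a..b, L * (C * (L * (r - a)) ^ n / n.factorial) =
      C * (L * (b - a)) ^ (n + 1) / (n + 1).factorial := by
  have hfac : ((n + 1).factorial : ℝ) = (n + 1) * n.factorial := by
    exact_mod_cast n.factorial_succ
  have hn : (n : ℝ) + 1 ≠ 0 := by positivity
  simp only [intervalIntegral.integral_const_mul, intervalIntegral.integral_div, mul_pow,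
    intervalIntegral.integral_comp_sub_right (fun r => r ^ n), integral_pow, sub_self, hfac]
  field_simp
  ring

theorem dist_drift_apply_le {u : VelocityField d} {s : I} {L R C : ℝ} {n : ℕ} (hL : 0 ≤ L)
    (hu : ∀ r ∈ Set.Icc (s : ℝ) 1, ∀ z ∈ Metric.closedBall (0 : Space d) R,
      ∀ z' ∈ Metric.closedBall (0 : Space d) R, ‖u r z - u r z'‖ ≤ L * ‖z - z'‖)
    {X Y : PathSpace d} (hX : X ∈ Metric.closedBall 0 R) (hY : Y ∈ Metric.closedBall 0 R)
    (h : ∀ t, dist (X t) (Y t) ≤ C * (L * ((s ⊔ t : I) - s)) ^ n / n.factorial) (t : I) :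
    dist (drift u s X t) (drift u s Y t) ≤
      C * (L * ((s ⊔ t : I) - s)) ^ (n + 1) / (n + 1).factorial := by
  have hst : (s : ℝ) ≤ (s ⊔ t : I) := le_sup_left
  have hball {Z : PathSpace d} (hZ : Z ∈ Metric.closedBall 0 R) (q : I) :
      Z q ∈ Metric.closedBall 0 R :=
    mem_closedBall_zero_iff.mpr ((Z.norm_coe_le_norm q).trans (mem_closedBall_zero_iff.mp hZ))
  rw [dist_eq_norm, drift_apply, drift_apply, ← intervalIntegral.integral_sub
    (integrable_velocity_along u X).intervalIntegrable
    (integrable_velocity_along u Y).intervalIntegrable, ← integral_mul_pow_div_factorial]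
  refine intervalIntegral.norm_integral_le_of_norm_le hst (ae_of_all _ fun r hr => ?_)
    (Continuous.intervalIntegrable (by fun_prop) _ _)
  have hr1 : r ≤ 1 := hr.2.trans (s ⊔ t).2.2
  have hrI : r ∈ I := ⟨s.2.1.trans hr.1.le, hr1⟩
  have hsr : ((s ⊔ ⟨r, hrI⟩ : I) : ℝ) = r :=
    congrArg Subtype.val (sup_of_le_right (show s ≤ ⟨r, hrI⟩ from hr.1.le))
  have hdist := h ⟨r, hrI⟩
  rw [hsr, dist_eq_norm] at hdist
  rw [at_eq hrI, at_eq hrI]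
  exact (hu r ⟨hr.1.le, hr1⟩ _ (hball hX _) _ (hball hY _)).trans
    (mul_le_mul_of_nonneg_left hdist hL)

theorem dist_iterate_picardMap_le {s : I} {x : Space d} {u : VelocityField d} {W : PathSpace d}
    {L R : ℝ} (hL : 0 ≤ L)
    (hu : ∀ r ∈ Set.Icc (s : ℝ) 1, ∀ z ∈ Metric.closedBall (0 : Space d) R,
      ∀ z' ∈ Metric.closedBall (0 : Space d) R, ‖u r z - u r z'‖ ≤ L * ‖z - z'‖)
    (hmaps : Set.MapsTo (picardMap s x u W) (Metric.closedBall 0 R) (Metric.closedBall 0 R))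
    {X Y : PathSpace d} (hX : X ∈ Metric.closedBall 0 R) (hY : Y ∈ Metric.closedBall 0 R) (n : ℕ) :
    dist ((picardMap s x u W)^[n] X) ((picardMap s x u W)^[n] Y) ≤
      L ^ n / n.factorial * dist X Y := by
  have hpoint (n : ℕ) : ∀ t, dist ((picardMap s x u W)^[n] X t) ((picardMap s x u W)^[n] Y t) ≤
      dist X Y * (L * ((s ⊔ t : I) - s)) ^ n / n.factorial := by
    induction n with
    | zero => simpa using fun t h0 ht => ContinuousMap.dist_apply_le_dist (⟨t, h0, ht⟩ : I)
    | succ n ih =>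
      intro t
      rw [Function.iterate_succ_apply', Function.iterate_succ_apply', dist_picardMap_apply]
      exact dist_drift_apply_le hL hu (hmaps.iterate n hX) (hmaps.iterate n hY) ih t
  refine (ContinuousMap.dist_le (by positivity)).mpr fun t => (hpoint n t).trans ?_
  have hst : (0 : ℝ) ≤ (s ⊔ t : I) - s := sub_nonneg.mpr le_sup_left
  have hle : ((s ⊔ t : I) : ℝ) - s ≤ 1 := by linarith [(s ⊔ t).2.2, s.2.1]
  rw [div_mul_eq_mul_div, mul_comm (L ^ n)]
  gcongr
  exact mul_le_of_le_one_right hL hle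

theorem exists_isFixedPt_picardMap {s : I} (hs : 0 < s) (x : Space d) (u : VelocityField d)
    (W : PathSpace d) :
    ∃ X, Function.IsFixedPt (picardMap s x u W) X ∧
      ∀ Y, Tendsto (fun n => (picardMap s x u W)^[n] Y) atTop (𝓝 X) := by
  set R := ‖x‖ + ‖u.primitiveBound‖ + ‖W‖ + ‖W‖
  have hmem := picardMap_mem_closedBall s x u W
  obtain ⟨L, hL, hu⟩ := u.exists_lipschitz hs R
  obtain ⟨X, hfix, hlim⟩ := exists_isFixedPt_tendsto_iterate Metric.isClosed_closedBall
    ⟨_, hmem 0⟩ (fun X _ => hmem X) (Real.summable_pow_div_factorial L)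
    fun n X hX Y hY => dist_iterate_picardMap_le hL hu (fun X _ => hmem X) hX hY n
  exact ⟨X, hfix, fun Y => (tendsto_add_atTop_iff_nat 1).mp (hlim _ (hmem Y))⟩

theorem isSolutionFrom_flow {s : I} (hs : 0 < s) (x : Space d) (u : VelocityField d)
    (W : PathSpace d) : IsSolutionFrom u s x W (flow s x u W) := by
  have h : ∃ X, IsSolutionFrom u s x W X :=
    (exists_isFixedPt_picardMap hs x u W).imp fun _ h => isSolutionFrom_iff.mpr h.1
  rw [flow, dif_pos h]
  exact h.choose_spec

theorem tendsto_iterate_picardMap {s : I} (hs : 0 < s) (x : Space d) (u : VelocityField d)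
    (W Y : PathSpace d) :
    Tendsto (fun n => (picardMap s x u W)^[n] Y) atTop (𝓝 (flow s x u W)) := by
  obtain ⟨X, -, hlim⟩ := exists_isFixedPt_picardMap hs x u W
  have hflow := isSolutionFrom_iff.mp (isSolutionFrom_flow hs x u W)
  have heq : flow s x u W = X := tendsto_nhds_unique
    (tendsto_const_nhds.congr fun n => (Function.iterate_fixed hflow n).symm) (hlim _)
  exact heq ▸ hlim Y

theorem measurable_iterate_picardMap (s : I) (x : Space d) (n : ℕ) :
    Measurable fun p : VelocityField d × PathSpace d => (picardMap s x p.1 p.2)^[n] 0 := by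
  induction n with
  | zero => exact measurable_const
  | succ n ih =>
    simp only [Function.iterate_succ_apply', picardMap]
    exact continuous_pathOfDrift.measurable.comp
      (f := fun p : VelocityField d × PathSpace d =>
        (s, x, drift p.1 s ((picardMap s x p.1 p.2)^[n] 0), p.2))
      (measurable_const.prodMk (measurable_const.prodMk
        ((measurable_drift measurable_fst ih s).prodMk measurable_snd)))

theorem measurable_flow {s : I} (hs : 0 < s) (x : Space d) :
    Measurable fun p : VelocityField d × PathSpace d => flow s x p.1 p.2 :=
  measurable_of_tendsto_metrizable (measurable_iterate_picardMap s x)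
    (tendsto_pi_nhds.mpr fun p => tendsto_iterate_picardMap hs x p.1 p.2 0)

theorem measurable_flow_noise {s : I} (hs : 0 < s) (x : Space d) (u : VelocityField d) :
    Measurable (flow s x u) :=
  (measurable_flow hs x).comp (f := fun W => (u, W)) measurable_prodMk_left

theorem restr_picardMap_congr {s t : I} (hst : s ≤ t) (x : Space d) (u : VelocityField d)
    {W W' X X' : PathSpace d} (hW : restr t W = restr t W') (hX : restr t X = restr t X') :
    restr t (picardMap s x u W X) = restr t (picardMap s x u W' X') := by
  have hdrift := restr_drift_congr u hst hX
  rw [restr_eq_restr_iff] at hW hdrift ⊢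
  intro r hr
  simp only [picardMap, pathOfDrift_apply, hdrift r hr, hW s hst, hW (s ⊔ r) (sup_le hst hr)]

theorem restr_flow_congr {s : I} (hs : 0 < s) (x : Space d) (u : VelocityField d) {t : I}
    {W W' : PathSpace d} (hW : restr t W = restr t W') :
    restr t (flow s x u W) = restr t (flow s x u W') := by
  rcases le_total s t with hst | hts
  · have hlim (W : PathSpace d) := ((continuous_restr t).tendsto _).comp
      (tendsto_iterate_picardMap hs x u W 0)
    refine tendsto_nhds_unique (hlim W) ((hlim W').congr fun n => ?_)
    change restr t ((picardMap s x u W')^[n] 0) = restr t ((picardMap s x u W)^[n] 0)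
    induction n with
    | zero => rfl
    | succ n ih =>
      rw [Function.iterate_succ_apply', Function.iterate_succ_apply']
      exact restr_picardMap_congr hst x u hW.symm ih
  · rw [restr_eq_restr_iff]
    intro r hr
    rw [(isSolutionFrom_flow hs x u W).1 r (hr.trans hts),
      (isSolutionFrom_flow hs x u W').1 r (hr.trans hts)]

/-- The extension of a path on `[0,t]` to `[0,1]` by its value at time `t`. -/
def extend (t : I) (w : PathSpaceUpTo d t) : PathSpace d :=
  w.comp ⟨fun r => ⟨min r t, min_le_right r t⟩, by fun_prop⟩

theorem continuous_extend (t : I) : Continuous (extend (d := d) t) :=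
  ContinuousMap.continuous_precomp _

theorem restr_extend_restr (t : I) (W : PathSpace d) :
    restr t (extend t (restr t W)) = restr t W :=
  restr_eq_restr_iff.mpr fun _ hr => congrArg W (min_eq_left hr)

theorem measurable_comap_restr_flow {s : I} (hs : 0 < s) (x : Space d) (u : VelocityField d)
    (t : I) :
    Measurable[MeasurableSpace.comap (restr t) inferInstance]
      fun W : PathSpace d => restr t (flow s x u W) := by
  have h : (fun W : PathSpace d => restr t (flow s x u W)) =
      (fun w => restr t (flow s x u (extend t w))) ∘ restr t :=
    funext fun W => restr_flow_congr hs x u (restr_extend_restr t W).symm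
  rw [h]
  exact ((measurable_restr t).comp ((measurable_flow_noise hs x u).comp
    (continuous_extend t).measurable)).comp (comap_measurable _)

theorem continuous_integral_velocity (u : VelocityField d) :
    Continuous fun p : PathSpace d × ℝ => ∫ r in (0 : ℝ)..p.2, u r (at_ p.1 r) := by
  refine continuous_iff_continuousAt.mpr fun ⟨X, b⟩ => ?_
  refine intervalIntegral.continuousAt_parametric_primitive_of_dominated u.bound (-|b| - 1)
    (|b| + 1) (fun X => (measurable_velocity_along u X).aestronglyMeasurable) ?_
    u.integrable_bound.intervalIntegrable ?_ ?_ ?_ (measure_singleton b)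
  · exact Eventually.of_forall fun X => ae_restrict_of_ae <| by
      filter_upwards [u.ae_norm_le_bound] with r hr using hr _
  · exact ae_of_all _ fun r => ((u.continuous_apply r).comp
      (continuous_uncurry_at_.comp (f := fun X : PathSpace d => (X, r)) (by fun_prop))).continuousAt
  · constructor <;> linarith [abs_nonneg b]
  · constructor <;> linarith [le_abs_self b, neg_abs_le b]

theorem continuous_drift (u : VelocityField d) :
    Continuous fun p : I × PathSpace d => drift u p.1 p.2 := by
  refine ContinuousMap.continuous_of_continuous_uncurry _ ?_
  have hinterval (X : PathSpace d) (a b : ℝ) :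
      IntervalIntegrable (fun r => u r (at_ X r)) volume a b :=
    (integrable_velocity_along u X).intervalIntegrable
  have hsub (q : (I × PathSpace d) × I) : drift u q.1.1 q.1.2 q.2 =
      (∫ r in (0 : ℝ)..(q.1.1 ⊔ q.2 : I), u r (at_ q.1.2 r)) -
        ∫ r in (0 : ℝ)..q.1.1, u r (at_ q.1.2 r) :=
    (intervalIntegral.integral_interval_sub_left (hinterval _ _ _) (hinterval _ _ _)).symm
  simp only [Function.uncurry_def, hsub]
  exact ((continuous_integral_velocity u).comp
      (f := fun q : (I × PathSpace d) × I => (q.1.2, ((q.1.1 ⊔ q.2 : I) : ℝ))) (by fun_prop)).sub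
    ((continuous_integral_velocity u).comp
      (f := fun q : (I × PathSpace d) × I => (q.1.2, (q.1.1 : ℝ))) (by fun_prop))

theorem isClosed_setOf_isSolutionFrom (u : VelocityField d) :
    IsClosed {p : I × Space d × PathSpace d × PathSpace d |
      IsSolutionFrom u p.1 p.2.1 p.2.2.1 p.2.2.2} := by
  simp only [isSolutionFrom_iff]
  refine isClosed_eq ?_ (by fun_prop)
  exact continuous_pathOfDrift.comp
    (f := fun p : I × Space d × PathSpace d × PathSpace d =>
      (p.1, p.2.1, drift u p.1 p.2.2.2, p.2.2.1))
    (continuous_fst.prodMk (continuous_snd.fst.prodMk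
      (((continuous_drift u).comp (f := fun p : I × Space d × PathSpace d × PathSpace d =>
        (p.1, p.2.2.2)) (by fun_prop)).prodMk continuous_snd.snd.fst)))

theorem IsSolutionFrom.isCaratheodorySolution {u : VelocityField d} {y : Space d}
    {W X : PathSpace d} (h : IsSolutionFrom u 0 y W X) : IsCaratheodorySolution u y W X :=
  fun t => h.2 t unitInterval.nonneg'

theorem isCaratheodorySolution_of_tendsto {u : VelocityField d} {y : Space d} {W X : PathSpace d}
    {ι : Type*} {l : Filter ι} [l.NeBot] {s : ι → I} {x : ι → Space d} {Ws Xs : ι → PathSpace d}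
    (hs : Tendsto s l (𝓝 0)) (hx : Tendsto x l (𝓝 y)) (hW : Tendsto Ws l (𝓝 W))
    (hX : Tendsto Xs l (𝓝 X)) (h : ∀ k, IsSolutionFrom u (s k) (x k) (Ws k) (Xs k)) :
    IsCaratheodorySolution u y W X :=
  IsSolutionFrom.isCaratheodorySolution <|
    (isClosed_setOf_isSolutionFrom u).mem_of_tendsto
      (hs.prodMk_nhds (hx.prodMk_nhds (hW.prodMk_nhds hX))) (Eventually.of_forall h)

theorem exists_isCompact_forall_isSolutionFrom (u : VelocityField d) {B : Set (Space d)}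
    (hB : IsCompact B) {K : Set (PathSpace d)} (hK : IsCompact K) :
    ∃ S : Set (PathSpace d), IsCompact S ∧
      ∀ s, ∀ x ∈ B, ∀ W ∈ K, ∀ X, IsSolutionFrom u s x W X → X ∈ S := by
  refine ⟨_, (isCompact_univ.prod (hB.prod
    ((isCompact_setOf_dist_le u.primitiveBound 0 (0 : Space d)).prod hK))).image
      continuous_pathOfDrift, fun s x hx W hW X hX => ?_⟩
  refine ⟨(s, x, drift u s X, W), ⟨Set.mem_univ s, hx, ⟨?_, dist_drift_le u s X⟩, hW⟩,
    isSolutionFrom_iff.mp hX⟩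
  exact drift_apply_of_le u unitInterval.nonneg' X

theorem exists_isCaratheodorySolution_pair {u : VelocityField d} {W : PathSpace d} {y : Space d}
    {s : ℕ → I} (hs : ∀ k, 0 < s k) (hs₀ : Tendsto s atTop (𝓝 0)) {z : ℕ → Space d}
    (hz : Tendsto z atTop (𝓝 y)) {t : I} {δ : ℝ}
    (h : ∃ᶠ k in atTop, δ ≤ dist (flow (s k) y u W t) (flow (s k) (z k) u W t)) :
    ∃ X₁ X₂, IsCaratheodorySolution u y W X₁ ∧ IsCaratheodorySolution u y W X₂ ∧
      δ ≤ dist (X₁ t) (X₂ t) := by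
  obtain ⟨S, hS, hmem⟩ := exists_isCompact_forall_isSolutionFrom u hz.isCompact_insert_range
    (isCompact_singleton (x := W))
  have hsol k x := isSolutionFrom_flow (hs k) x u W
  obtain ⟨φ, hφ, hfar⟩ := extraction_of_frequently_atTop h
  obtain ⟨⟨X₁, X₂⟩, -, ψ, hψ, hlim⟩ := (hS.prod hS).tendsto_subseq
    (x := fun k => (flow (s (φ k)) y u W, flow (s (φ k)) (z (φ k)) u W)) fun k =>
      ⟨hmem _ _ (Set.mem_insert y _) _ rfl _ (hsol _ _),
        hmem _ _ (Set.mem_insert_of_mem y ⟨φ k, rfl⟩) _ rfl _ (hsol _ _)⟩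
  have hφψ : Tendsto (φ ∘ ψ) atTop atTop := hφ.tendsto_atTop.comp hψ.tendsto_atTop
  refine ⟨X₁, X₂, ?_, ?_, ?_⟩
  · exact isCaratheodorySolution_of_tendsto (hs₀.comp hφψ) (tendsto_const_nhds (x := y))
      tendsto_const_nhds hlim.fst_nhds fun k => hsol _ _
  · exact isCaratheodorySolution_of_tendsto (hs₀.comp hφψ) (hz.comp hφψ)
      tendsto_const_nhds hlim.snd_nhds fun k => hsol _ _
  · have heval (X : PathSpace d) : Tendsto (fun X' : PathSpace d => X' t) (𝓝 X) (𝓝 (X t)) :=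
      (continuous_eval_const t).tendsto X
    exact ge_of_tendsto' (((heval X₁).comp hlim.fst_nhds).dist ((heval X₂).comp hlim.snd_nhds))
      fun k => hfar (ψ k)

/-! ### Weak solutions as limits of flows -/

instance instCompactSpaceIic (t : I) : CompactSpace (Set.Iic t) :=
  isCompact_iff_compactSpace.mp isClosed_Iic.isCompact

/-- The conditional law of the noise given its past up to time `t`. -/
def noiseKernel (𝕎 : Measure (PathSpace d)) [IsFiniteMeasure 𝕎] (t : I) :
    Kernel (PathSpaceUpTo d t) (PathSpace d) :=
  condDistrib (fun W => W) (restr t) 𝕎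

instance instIsMarkovKernelNoiseKernel (𝕎 : Measure (PathSpace d)) [IsFiniteMeasure 𝕎] (t : I) :
    IsMarkovKernel (noiseKernel 𝕎 t) :=
  inferInstanceAs (IsMarkovKernel (condDistrib _ _ _))

/-- The past up to time `t` of the noise and of the solution, jointly with the whole noise path, for
a pair `(X, W)`. -/
def pastWithNoise (t : I) (p : PathSpace d × PathSpace d) :
    (PathSpaceUpTo d t × PathSpaceUpTo d t) × PathSpace d :=
  ((restr t p.2, restr t p.1), p.2)

theorem continuous_pastWithNoise (t : I) : Continuous (pastWithNoise (d := d) t) :=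
  (((continuous_restr t).comp continuous_snd).prodMk
    ((continuous_restr t).comp continuous_fst)).prodMk continuous_snd

/-- Condition (ii) of a weak solution: `π^t X` and `W` are conditionally independent given `π^t W`
for every `t`. -/
def IsNonanticipating (𝕏 : Measure (PathSpace d × PathSpace d)) [IsFiniteMeasure 𝕏] : Prop :=
  ∀ t : I, CondIndepFun
    (MeasurableSpace.comap (fun p : PathSpace d × PathSpace d => restr t p.2) inferInstance)
    ((measurable_restr t).comp measurable_snd).comap_le (fun p => restr t p.1) (fun p => p.2) 𝕏

theorem isNonanticipating_iff {𝕏 : Measure (PathSpace d × PathSpace d)} [IsFiniteMeasure 𝕏]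
    {𝕎 : Measure (PathSpace d)} [IsFiniteMeasure 𝕎] (h : 𝕏.map Prod.snd = 𝕎) :
    IsNonanticipating 𝕏 ↔ ∀ t, 𝕏.map (pastWithNoise t) =
      (𝕏.map (pastWithNoise t)).fst ⊗ₘ (noiseKernel 𝕎 t).prodMkRight (PathSpaceUpTo d t) := by
  refine forall_congr' fun t => ?_
  have hkernel : condDistrib (fun p => p.2) (fun p => restr t p.2) 𝕏 =ᵐ[𝕏.map fun p => restr t p.2]
      noiseKernel 𝕎 t := by
    subst h
    exact (condDistrib_map (measurable_restr t).aemeasurable measurable_id.aemeasurable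
      measurable_snd.aemeasurable).symm
  rw [Measure.fst, Measure.map_map measurable_fst (continuous_pastWithNoise t).measurable]
  exact condIndepFun_iff_map_eq_compProd ((measurable_restr t).comp measurable_snd)
    ((measurable_restr t).comp measurable_fst) measurable_snd hkernel

section Limits

variable {ι : Type*} {l : Filter ι} {𝕏s : ι → ProbabilityMeasure (PathSpace d × PathSpace d)}
  {𝕏 : ProbabilityMeasure (PathSpace d × PathSpace d)} {𝕎 : ProbabilityMeasure (PathSpace d)}

theorem map_snd_eq_of_tendsto [l.NeBot] (h : Tendsto 𝕏s l (𝓝 𝕏))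
    (hmarg : ∀ i, (𝕏s i : Measure (PathSpace d × PathSpace d)).map Prod.snd = 𝕎) :
    (𝕏 : Measure (PathSpace d × PathSpace d)).map Prod.snd = 𝕎 := by
  have hmap := ProbabilityMeasure.tendsto_map_of_tendsto_of_continuous 𝕏s 𝕏 h continuous_snd
  have hconst : Tendsto (fun _ : ι => 𝕎) l (𝓝 𝕎) := tendsto_const_nhds
  have hlim : 𝕏.map continuous_snd.measurable.aemeasurable = 𝕎 :=
    tendsto_nhds_unique hmap (hconst.congr fun i => Subtype.ext (hmarg i).symm)
  exact congrArg Subtype.val hlim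

theorem ae_noiseKernel_eq {𝕏 : Measure (PathSpace d × PathSpace d)} {t : I}
    (hmarg : 𝕏.map Prod.snd = 𝕎) {κ : PathSpaceUpTo d t → ProbabilityMeasure (PathSpace d)}
    (hκ : ∀ᵐ w ∂(𝕎 : Measure (PathSpace d)).map (restr t), noiseKernel 𝕎 t w = κ w) :
    ∀ᵐ a ∂(𝕏.map (pastWithNoise t)).fst, noiseKernel 𝕎 t a.1 = κ a.1 := by
  have hfst : (𝕏.map (pastWithNoise t)).fst.map Prod.fst =
      (𝕎 : Measure (PathSpace d)).map (restr t) := by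
    rw [Measure.fst, Measure.map_map measurable_fst (continuous_pastWithNoise t).measurable,
      Measure.map_map measurable_fst (measurable_fst.comp (continuous_pastWithNoise t).measurable),
      ← hmarg, Measure.map_map (measurable_restr t) measurable_snd]
    rfl
  rw [← hfst] at hκ
  exact ae_of_ae_map measurable_fst.aemeasurable hκ

theorem isNonanticipating_of_tendsto (h𝕎 : IsRegularNoise 𝕎) [l.NeBot] (h : Tendsto 𝕏s l (𝓝 𝕏))
    (hmarg : ∀ i, (𝕏s i : Measure (PathSpace d × PathSpace d)).map Prod.snd = 𝕎)
    (hpast : ∀ i, IsNonanticipating (𝕏s i : Measure (PathSpace d × PathSpace d))) :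
    IsNonanticipating (𝕏 : Measure (PathSpace d × PathSpace d)) := by
  have hlim := map_snd_eq_of_tendsto h hmarg
  rw [isNonanticipating_iff hlim]
  intro t
  obtain ⟨κ, hκ, hκ𝕎⟩ := h𝕎 t
  exact eq_compProd_of_tendsto (hκ.comp continuous_fst)
    (ProbabilityMeasure.tendsto_map_of_tendsto_of_continuous 𝕏s 𝕏 h (continuous_pastWithNoise t))
    (fun i => ae_noiseKernel_eq (hmarg i) hκ𝕎) (ae_noiseKernel_eq hlim hκ𝕎)
    fun i => (isNonanticipating_iff (hmarg i)).mp (hpast i) t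

end Limits

/-- The joint law `(X, W)` of the solution started from `x` at time `s > 0` and the noise. -/
def flowLaw (𝕎 : ProbabilityMeasure (PathSpace d)) (u : VelocityField d) {s : I} (hs : 0 < s)
    (x : Space d) : ProbabilityMeasure (PathSpace d × PathSpace d) :=
  𝕎.map (f := fun W => (flow s x u W, W))
    ((measurable_flow_noise hs x u).prodMk measurable_id).aemeasurable

theorem flowLaw_map_snd (𝕎 : ProbabilityMeasure (PathSpace d)) (u : VelocityField d) {s : I}
    (hs : 0 < s) (x : Space d) :
    (flowLaw 𝕎 u hs x : Measure (PathSpace d × PathSpace d)).map Prod.snd = 𝕎 :=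
  (Measure.map_map measurable_snd ((measurable_flow_noise hs x u).prodMk measurable_id)).trans
    Measure.map_id

theorem isNonanticipating_flowLaw (𝕎 : ProbabilityMeasure (PathSpace d)) (u : VelocityField d)
    {s : I} (hs : 0 < s) (x : Space d) :
    IsNonanticipating (flowLaw 𝕎 u hs x : Measure (PathSpace d × PathSpace d)) := fun t =>
  (condIndepFun_map_iff ((measurable_flow_noise hs x u).prodMk measurable_id)
    ((measurable_restr t).comp measurable_snd) ((measurable_restr t).comp measurable_fst)
    measurable_snd).mpr
      (condIndepFun_of_measurable_left (measurable_comap_restr_flow hs x u t) measurable_id)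

theorem ae_flowLaw_isSolutionFrom (𝕎 : ProbabilityMeasure (PathSpace d)) (u : VelocityField d)
    {s : I} (hs : 0 < s) (x : Space d) :
    ∀ᵐ p ∂(flowLaw 𝕎 u hs x : Measure (PathSpace d × PathSpace d)),
      p ∈ {p | IsSolutionFrom u s x p.2 p.1} := by
  have hclosed : IsClosed {p : PathSpace d × PathSpace d | IsSolutionFrom u s x p.2 p.1} :=
    (isClosed_setOf_isSolutionFrom u).preimage
      (f := fun p : PathSpace d × PathSpace d => (s, x, p.2, p.1)) (by fun_prop)
  exact (ae_map_iff ((measurable_flow_noise hs x u).prodMk measurable_id).aemeasurable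
    hclosed.measurableSet).mpr (ae_of_all _ (isSolutionFrom_flow hs x u))

theorem isWeakSolution_of_tendsto {𝕎 : ProbabilityMeasure (PathSpace d)} (h𝕎 : IsRegularNoise 𝕎)
    {u : VelocityField d} {y : Space d} {s : ℕ → I} (hs : ∀ k, 0 < s k)
    (hs₀ : Tendsto s atTop (𝓝 0)) {x : ℕ → Space d} (hx : Tendsto x atTop (𝓝 y))
    {l : Filter ℕ} [l.NeBot] (hl : l ≤ atTop)
    {𝕏 : ProbabilityMeasure (PathSpace d × PathSpace d)}
    (h : Tendsto (fun k => flowLaw 𝕎 u (hs k) (x k)) l (𝓝 𝕏)) : IsWeakSolution u y 𝕎 𝕏 where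
  marginal := map_snd_eq_of_tendsto h fun k => flowLaw_map_snd 𝕎 u (hs k) (x k)
  nonanticipating := isNonanticipating_of_tendsto h𝕎 h
    (fun k => flowLaw_map_snd 𝕎 u (hs k) (x k)) fun k => isNonanticipating_flowLaw 𝕎 u (hs k) (x k)
  solves := by
    filter_upwards [ae_exists_tendsto_of_tendsto hl h
      fun k => ae_flowLaw_isSolutionFrom 𝕎 u (hs k) (x k)] with p hp
    obtain ⟨φ, q, hφ, hq, hqp⟩ := hp
    exact isCaratheodorySolution_of_tendsto (hs₀.comp hφ) (hx.comp hφ) hqp.snd_nhds hqp.fst_nhds hq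

theorem measurable_flowPair {s : I} (hs : 0 < s) (x z : Space d) (u : VelocityField d) :
    Measurable fun W => (flow s x u W, flow s z u W, W) :=
  (measurable_flow_noise hs x u).prodMk ((measurable_flow_noise hs z u).prodMk measurable_id)

/-- The joint law of the solutions started from `x` and from `z` at time `s > 0` and of the
noise. -/
def flowPairLaw (𝕎 : ProbabilityMeasure (PathSpace d)) (u : VelocityField d) {s : I} (hs : 0 < s)
    (x z : Space d) : ProbabilityMeasure (PathSpace d × PathSpace d × PathSpace d) :=
  𝕎.map (measurable_flowPair hs x z u).aemeasurable

theorem isTightMeasureSet_range_flowPairLaw (𝕎 : ProbabilityMeasure (PathSpace d))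
    (u : VelocityField d) {ι : Type*} {s : ι → I} (hs : ∀ k, 0 < s k) {B : Set (Space d)}
    (hB : IsCompact B) {x z : ι → Space d} (hx : ∀ k, x k ∈ B) (hz : ∀ k, z k ∈ B) :
    IsTightMeasureSet (Set.range fun k => (flowPairLaw 𝕎 u (hs k) (x k) (z k) :
      Measure (PathSpace d × PathSpace d × PathSpace d))) := by
  rw [isTightMeasureSet_iff_exists_isCompact_measure_compl_le]
  intro η hη
  obtain ⟨K, hK, hKη⟩ := isTightMeasureSet_iff_exists_isCompact_measure_compl_le.mp
    (isTightMeasureSet_singleton (μ := (𝕎 : Measure (PathSpace d)))) η hη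
  obtain ⟨S, hS, hmem⟩ := exists_isCompact_forall_isSolutionFrom u hB hK
  have hSK := hS.prod (hS.prod hK)
  refine ⟨S ×ˢ S ×ˢ K, hSK, ?_⟩
  rintro _ ⟨k, rfl⟩
  have hsub : (fun W => (flow (s k) (x k) u W, flow (s k) (z k) u W, W)) ⁻¹' (S ×ˢ S ×ˢ K)ᶜ ⊆ Kᶜ :=
    fun W hW hWK => hW ⟨hmem _ _ (hx k) W hWK _ (isSolutionFrom_flow (hs k) (x k) u W),
      hmem _ _ (hz k) W hWK _ (isSolutionFrom_flow (hs k) (z k) u W), hWK⟩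
  exact (Measure.map_apply (measurable_flowPair (hs k) (x k) (z k) u)
    hSK.isClosed.measurableSet.compl).trans_le ((measure_mono hsub).trans (hKη _ rfl))

section Coupling

variable {𝕎 : ProbabilityMeasure (PathSpace d)} {u : VelocityField d} {y : Space d} {s : ℕ → I}
  {z : ℕ → Space d}

theorem isWeakCoupling_of_tendsto (h𝕎 : IsRegularNoise 𝕎) (hs : ∀ k, 0 < s k)
    (hs₀ : Tendsto s atTop (𝓝 0)) {x : ℕ → Space d} (hx : Tendsto x atTop (𝓝 y))
    (hz : Tendsto z atTop (𝓝 y)) {l : Filter ℕ} [l.NeBot] (hl : l ≤ atTop)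
    {𝕐 : ProbabilityMeasure (PathSpace d × PathSpace d × PathSpace d)}
    (h : Tendsto (fun k => flowPairLaw 𝕎 u (hs k) (x k) (z k)) l (𝓝 𝕐)) :
    IsWeakCoupling u y 𝕎 𝕐 := by
  constructor
  · refine isWeakSolution_of_tendsto h𝕎 hs hs₀ hx hl
      ((ProbabilityMeasure.tendsto_map_of_tendsto_of_continuous _ _ h (by fun_prop)).congr
        fun k => Subtype.ext ?_)
    exact Measure.map_map (by fun_prop) (measurable_flowPair (hs k) (x k) (z k) u)
  · refine isWeakSolution_of_tendsto h𝕎 hs hs₀ hz hl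
      ((ProbabilityMeasure.tendsto_map_of_tendsto_of_continuous _ _ h (by fun_prop)).congr
        fun k => Subtype.ext ?_)
    exact Measure.map_map (by fun_prop) (measurable_flowPair (hs k) (x k) (z k) u)

theorem exists_isWeakCoupling_dist_lt_le (h𝕎 : IsRegularNoise 𝕎) (hs : ∀ k, 0 < s k)
    (hs₀ : Tendsto s atTop (𝓝 0)) (hz : Tendsto z atTop (𝓝 y)) {t : I} {δ : ℝ} {γ : ℝ≥0∞}
    (h : ∃ᶠ k in atTop, (𝕎 : Measure (PathSpace d))
      {W | dist (flow (s k) y u W t) (flow (s k) (z k) u W t) < δ} ≤ γ) :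
    ∃ 𝕐 : ProbabilityMeasure (PathSpace d × PathSpace d × PathSpace d), IsWeakCoupling u y 𝕎 𝕐 ∧
      (𝕐 : Measure (PathSpace d × PathSpace d × PathSpace d))
        {p | dist (p.1 t) (p.2.1 t) < δ} ≤ γ := by
  let good : Set ℕ := {k | (𝕎 : Measure (PathSpace d))
    {W | dist (flow (s k) y u W t) (flow (s k) (z k) u W t) < δ} ≤ γ}
  have : (atTop ⊓ 𝓟 good).NeBot := frequently_mem_iff_neBot.mp h
  obtain ⟨g, hg, 𝕐, h𝕐⟩ := exists_ultrafilter_tendsto (atTop ⊓ 𝓟 good)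
    (isTightMeasureSet_range_flowPairLaw 𝕎 u hs hz.isCompact_insert_range
      (fun _ => Set.mem_insert y _) fun k => Set.mem_insert_of_mem y ⟨k, rfl⟩)
  have hopen : IsOpen {p : PathSpace d × PathSpace d × PathSpace d |
      dist (p.1 t) (p.2.1 t) < δ} := isOpen_lt (by fun_prop) continuous_const
  refine ⟨𝕐, isWeakCoupling_of_tendsto h𝕎 hs hs₀ tendsto_const_nhds hz (hg.trans inf_le_left) h𝕐,
    (ProbabilityMeasure.le_liminf_measure_open_of_tendsto h𝕐 hopen).trans ?_⟩
  refine liminf_le_of_frequently_le' (Eventually.frequently ?_)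
  filter_upwards [hg (mem_inf_of_right (mem_principal_self _))] with k hk
  exact (Measure.map_apply (measurable_flowPair (hs k) y (z k) u) hopen.measurableSet).trans_le hk

end Coupling

/-! ### Separating sequences -/

/-- The event that the solutions started from `x` and from `z` at time `s` are `δ`-close at
time `t`. -/
def closeEvent (s t : I) (δ : ℝ) (x z : Space d) : Set (VelocityField d × PathSpace d) :=
  {p | dist (flow s x p.1 p.2 t) (flow s z p.1 p.2 t) < δ}

theorem measurableSet_closeEvent {s : I} (hs : 0 < s) (t : I) (δ : ℝ) (x z : Space d) :
    MeasurableSet (closeEvent s t δ x z) :=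
  have heval : Measurable fun X : PathSpace d => X t := (continuous_eval_const t).measurable
  measurableSet_lt ((heval.comp (measurable_flow hs x)).dist (heval.comp (measurable_flow hs z)))
    measurable_const

theorem restr_ne_restr_of_dist_pos {ε t : I} (ht : t ≤ ε) {X X' : PathSpace d}
    (h : 0 < dist (X t) (X' t)) : restr ε X ≠ restr ε X' :=
  fun hX => dist_pos.mp h (restr_eq_restr_iff.mp hX t ht)

/-- Solutions started at the times `s k ↓ 0` from `y` and from `z k → y` separate: for `k` large,
the probability that they are `δ j`-close at time `t j` is at most `2 ^ (-(j + 1))`, where `t j` is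
arbitrarily small. This is the sequential form in which explosive separation is used. -/
structure IsSeparating (𝕌 : Measure (VelocityField d)) (𝕎 : Measure (PathSpace d)) (y : Space d)
    (z : ℕ → Space d) (s t : ℕ → I) (δ : ℕ → ℝ) : Prop where
  start_pos : ∀ k, 0 < s k
  tendsto_start : Tendsto s atTop (𝓝 0)
  tendsto_point : Tendsto z atTop (𝓝 y)
  tendsto_time : Tendsto t atTop (𝓝 0)
  gap_pos : ∀ j, 0 < δ j
  prod_closeEvent_le : ∀ j, ∀ᶠ k in atTop,
    (𝕌.prod 𝕎) (closeEvent (s k) (t j) (δ j) y (z k)) ≤ 2⁻¹ ^ (j + 1)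

section Existence

variable {𝕌 : ProbabilityMeasure (VelocityField d)} {𝕎 : Measure (PathSpace d)}
  [IsProbabilityMeasure 𝕎] {T : ℕ → I} {y : Space d} {z : ℕ → Space d} {δ : ℕ → ℝ}

theorem ExplosivelySeparating.tendsto_limsup_seq {W : PathSpace d}
    (hW : ExplosivelySeparating 𝕌 T W) (hz : Tendsto z atTop (𝓝[≠] y))
    (hδ : Tendsto δ atTop (𝓝[>] 0)) :
    Tendsto (fun n => limsup (fun i => limsup (fun k => limsup (fun m =>
      (𝕌 : Measure (VelocityField d))
        {u | dist (flow (T m) y u W (T n)) (flow (T m) (z k) u W (T n)) < δ i})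
      atTop) atTop) atTop) atTop (𝓝 0) := by
  obtain ⟨hzy, hne⟩ := tendsto_nhdsWithin_iff.mp hz
  have hpair : Tendsto (fun k => (y, z k)) atTop
      (comap (fun p : Space d × Space d => dist p.1 p.2) (𝓝[>] 0)) :=
    tendsto_comap_iff.mpr <| tendsto_nhdsWithin_iff.mpr
      ⟨by simpa only [dist_self] using! (tendsto_const_nhds (x := y)).dist hzy,
        hne.mono fun k hk => dist_pos.mpr (Ne.symm hk)⟩
  have hle (n : ℕ) := limsup_limsup_comp_le (fun (δ : ℝ) (p : Space d × Space d) =>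
    limsup (fun m => (𝕌 : Measure (VelocityField d))
      {u | dist (flow (T m) p.1 u W (T n)) (flow (T m) p.2 u W (T n)) < δ}) atTop) hδ hpair
  unfold ExplosivelySeparating at hW
  exact tendsto_of_tendsto_of_tendsto_of_le_of_le tendsto_const_nhds hW (fun _ => zero_le) hle

theorem tendsto_limsup_prod_closeEvent (hT : ∀ n, 0 < T n)
    (hsep : ∀ᵐ W ∂𝕎, ExplosivelySeparating 𝕌 T W) (hz : Tendsto z atTop (𝓝[≠] y))
    (hδ : Tendsto δ atTop (𝓝[>] 0)) :
    Tendsto (fun n => limsup (fun i => limsup (fun k => limsup (fun m =>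
      (𝕌 : Measure (VelocityField d)).prod 𝕎 (closeEvent (T m) (T n) (δ i) y (z k)))
      atTop) atTop) atTop) atTop (𝓝 0) := by
  let a (n i k m : ℕ) (W : PathSpace d) : ℝ≥0∞ := (𝕌 : Measure (VelocityField d))
    {u | dist (flow (T m) y u W (T n)) (flow (T m) (z k) u W (T n)) < δ i}
  let b (n i k : ℕ) (W : PathSpace d) : ℝ≥0∞ := limsup (fun m => a n i k m W) atTop
  let c (n i : ℕ) (W : PathSpace d) : ℝ≥0∞ := limsup (fun k => b n i k W) atTop
  let e (n : ℕ) (W : PathSpace d) : ℝ≥0∞ := limsup (fun i => c n i W) atTop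
  have hclose (n i k m : ℕ) : MeasurableSet (closeEvent (T m) (T n) (δ i) y (z k)) :=
    measurableSet_closeEvent (hT m) _ _ _ _
  have ha (n i k m : ℕ) : Measurable (a n i k m) := measurable_measure_prodMk_right (hclose n i k m)
  have hb (n i k : ℕ) : Measurable (b n i k) := .limsup (ha n i k)
  have hc (n i : ℕ) : Measurable (c n i) := .limsup (hb n i)
  have ha₁ (n i k m : ℕ) (W : PathSpace d) : a n i k m W ≤ 1 := prob_le_one
  have hb₁ (n i k : ℕ) (W : PathSpace d) : b n i k W ≤ 1 :=
    limsup_le_of_le (h := .of_forall fun m => ha₁ n i k m W)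
  have hc₁ (n i : ℕ) (W : PathSpace d) : c n i W ≤ 1 :=
    limsup_le_of_le (h := .of_forall fun k => hb₁ n i k W)
  have he₁ (n : ℕ) (W : PathSpace d) : e n W ≤ 1 :=
    limsup_le_of_le (h := .of_forall fun i => hc₁ n i W)
  have hlim : Tendsto (fun n => ∫⁻ W, e n W ∂𝕎) atTop (𝓝 0) := by
    simpa only [lintegral_zero] using tendsto_lintegral_of_dominated_convergence (f := fun _ => 0)
      1 (fun n => .limsup (hc n)) (fun n => ae_of_all _ (he₁ n)) (by simp)
      (hsep.mono fun W hW => hW.tendsto_limsup_seq hz hδ)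
  refine tendsto_of_tendsto_of_tendsto_of_le_of_le tendsto_const_nhds hlim (fun _ => zero_le)
    fun n => ?_
  exact limsup_le_lintegral_limsup (hc n) (hc₁ n) fun i =>
    limsup_le_lintegral_limsup (hb n i) (hb₁ n i) fun k =>
      limsup_le_lintegral_limsup (ha n i k) (ha₁ n i k) fun m =>
        (Measure.prod_apply_symm (hclose n i k m)).le

theorem exists_isSeparating (hd : 1 ≤ d) (hT : ∀ n, 0 < T n) (hT₀ : Tendsto T atTop (𝓝 0))
    (hsep : ∀ᵐ W ∂𝕎, ExplosivelySeparating 𝕌 T W) (y : Space d) :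
    ∃ z s t δ, IsSeparating (𝕌 : Measure (VelocityField d)) 𝕎 y z s t δ := by
  have : Nonempty (Fin d) := ⟨⟨0, hd⟩⟩
  have : (𝓝[≠] y).NeBot := Module.punctured_nhds_neBot ℝ (Space d) y
  obtain ⟨z, hz⟩ := exists_seq_tendsto (𝓝[≠] y)
  obtain ⟨δ, -, hδ_pos, hδ⟩ := exists_seq_strictAnti_tendsto (0 : ℝ)
  have hlim := tendsto_limsup_prod_closeEvent hT hsep hz
    (tendsto_nhdsWithin_iff.mpr ⟨hδ, .of_forall hδ_pos⟩)
  have hchoice (j : ℕ) : ∃ n ≥ j, ∃ i, ∀ᶠ k in atTop, ∀ᶠ m in atTop,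
      (𝕌 : Measure (VelocityField d)).prod 𝕎 (closeEvent (T m) (T n) (δ i) y (z k)) <
        2⁻¹ ^ (j + 1) := by
    have hpos : (0 : ℝ≥0∞) < 2⁻¹ ^ (j + 1) := ENNReal.pow_pos (by simp) _
    obtain ⟨n, hn, hjn⟩ := ((hlim.eventually_lt_const hpos).and (eventually_ge_atTop j)).exists
    obtain ⟨i, hi⟩ := (eventually_lt_of_limsup_lt hn).exists
    exact ⟨n, hjn, i, (eventually_lt_of_limsup_lt hi).mono fun k => eventually_lt_of_limsup_lt⟩
  choose N hN i hNi using hchoice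
  obtain ⟨M, hM, hclose⟩ := exists_tendsto_atTop_of_eventually_eventually hNi
  exact ⟨z, T ∘ M, T ∘ N, δ ∘ i, {
    start_pos := fun k => hT _
    tendsto_start := hT₀.comp hM
    tendsto_point := hz.mono_right nhdsWithin_le_nhds
    tendsto_time := hT₀.comp (tendsto_atTop_mono hN tendsto_id)
    gap_pos := fun j => hδ_pos _
    prod_closeEvent_le := fun j => (hclose j).mono fun k => le_of_lt }⟩

end Existence

namespace IsSeparating

variable {𝕌 : Measure (VelocityField d)} {𝕎 : ProbabilityMeasure (PathSpace d)} {y : Space d}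
  {z : ℕ → Space d} {s t : ℕ → I} {δ : ℕ → ℝ}

theorem ae_exists_isCaratheodorySolution_pair (h : IsSeparating 𝕌 𝕎 y z s t δ) :
    ∀ᵐ q ∂(𝕌.prod (𝕎 : Measure (PathSpace d))), ∀ ε : I, 0 < ε → ∃ X₁ X₂ : PathSpace d,
      IsCaratheodorySolution q.1 y q.2 X₁ ∧ IsCaratheodorySolution q.1 y q.2 X₂ ∧
        restr ε X₁ ≠ restr ε X₂ := by
  have hmeas (j k : ℕ) : MeasurableSet (closeEvent (s k) (t j) (δ j) y (z k)) :=
    measurableSet_closeEvent (h.start_pos k) _ _ _ _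
  have hliminf := ae_tendsto_liminf_zero
    (f := fun j k => (closeEvent (s k) (t j) (δ j) y (z k)).indicator 1)
    (fun j k => measurable_one.indicator (hmeas j k)) (by simp [tsum_two_inv_pow_succ])
    fun j => ((h.prod_closeEvent_le j).mono fun k hk =>
      (lintegral_indicator_one (hmeas j k)).trans_le hk).frequently
  filter_upwards [hliminf] with q hq ε hε
  obtain ⟨j, hj, hjε⟩ :=
    ((hq.eventually_lt_const one_pos).and (h.tendsto_time.eventually_le_const hε)).exists
  obtain ⟨X₁, X₂, hX₁, hX₂, hX⟩ := exists_isCaratheodorySolution_pair (t := t j) (δ := δ j)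
    h.start_pos h.tendsto_start h.tendsto_point <|
      (frequently_lt_of_liminf_lt (by isBoundedDefault) hj).mono fun k hk => by
        by_contra hlt
        have hclose : q ∈ closeEvent (s k) (t j) (δ j) y (z k) := not_le.mp hlt
        exact hk.ne (Set.indicator_of_mem hclose _)
  exact ⟨X₁, X₂, hX₁, hX₂, restr_ne_restr_of_dist_pos hjε ((h.gap_pos j).trans_le hX)⟩

theorem ae_exists_isWeakCoupling (h : IsSeparating 𝕌 𝕎 y z s t δ) (h𝕎 : IsRegularNoise 𝕎) :
    ∀ᵐ u ∂𝕌, ∀ ε : I, 0 < ε → ∀ γ : ℝ≥0∞, 0 < γ →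
      ∃ 𝕐 : ProbabilityMeasure (PathSpace d × PathSpace d × PathSpace d),
        IsWeakCoupling u y 𝕎 𝕐 ∧
          (𝕐 : Measure (PathSpace d × PathSpace d × PathSpace d)) (coincidence d ε) ≤ γ := by
  have hmeas (j k : ℕ) : MeasurableSet (closeEvent (s k) (t j) (δ j) y (z k)) :=
    measurableSet_closeEvent (h.start_pos k) _ _ _ _
  have hliminf := ae_tendsto_liminf_zero
    (f := fun j k u => (𝕎 : Measure (PathSpace d))
      (Prod.mk u ⁻¹' closeEvent (s k) (t j) (δ j) y (z k)))
    (fun j k => measurable_measure_prodMk_left (hmeas j k)) (by simp [tsum_two_inv_pow_succ])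
    fun j => ((h.prod_closeEvent_le j).mono fun k hk =>
      (Measure.prod_apply (hmeas j k)).symm.trans_le hk).frequently
  filter_upwards [hliminf] with u hu ε hε γ hγ
  obtain ⟨j, hj, hjε⟩ :=
    ((hu.eventually_lt_const hγ).and (h.tendsto_time.eventually_le_const hε)).exists
  obtain ⟨𝕐, h𝕐, hle⟩ := exists_isWeakCoupling_dist_lt_le h𝕎 h.start_pos h.tendsto_start
    h.tendsto_point ((frequently_lt_of_liminf_lt (by isBoundedDefault) hj).mono fun k => le_of_lt)
  refine ⟨𝕐, h𝕐, (measure_mono fun p hp => ?_).trans hle⟩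
  by_contra hdist
  exact restr_ne_restr_of_dist_pos hjε ((h.gap_pos j).trans_le (not_lt.mp hdist)) hp

end IsSeparating

/-! ### Weak solutions under mixtures and weak uniqueness -/

variable {u : VelocityField d} {y : Space d} {𝕎 : ProbabilityMeasure (PathSpace d)}

theorem isWeakSolution_mixture {𝕏s : ℕ → ProbabilityMeasure (PathSpace d × PathSpace d)}
    (h : ∀ n, IsWeakSolution u y 𝕎 (𝕏s n)) : IsWeakSolution u y 𝕎 (mixture 𝕏s) := by
  have hsnd : (mixture 𝕏s : Measure (PathSpace d × PathSpace d)).map Prod.snd = 𝕎 := by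
    simp only [map_mixture measurable_snd, (h _).marginal, sum_two_inv_pow_succ_smul]
  refine ⟨hsnd, (isNonanticipating_iff hsnd).mpr fun t => ?_,
    ae_mixture_iff.mpr fun n => (h n).solves⟩
  have hmap (n : ℕ) := (isNonanticipating_iff (h n).marginal).mp (h n).nonanticipating t
  have hpast : Measurable (pastWithNoise (d := d) t) := (continuous_pastWithNoise t).measurable
  have hfst : (Measure.sum fun n : ℕ => (2⁻¹ : ℝ≥0∞) ^ (n + 1) • (𝕏s n : Measure _).map
      (pastWithNoise (d := d) t)).fst = Measure.sum fun n : ℕ => (2⁻¹ : ℝ≥0∞) ^ (n + 1) •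
        ((𝕏s n : Measure _).map (pastWithNoise (d := d) t)).fst := by
    simp only [Measure.fst, Measure.map_sum measurable_fst.aemeasurable, Measure.map_smul]
  rw [map_mixture hpast, hfst, Measure.compProd_sum_left]
  congr 1 with n : 1
  rw [Measure.compProd_smul_left, ← hmap n]

theorem IsWeakSolution.exists_absolutelyContinuous {ι : Type*} [Countable ι] [Nonempty ι]
    {𝕏s : ι → ProbabilityMeasure (PathSpace d × PathSpace d)}
    (h : ∀ i, IsWeakSolution u y 𝕎 (𝕏s i)) :
    ∃ 𝕏 : ProbabilityMeasure (PathSpace d × PathSpace d), IsWeakSolution u y 𝕎 𝕏 ∧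
      ∀ i, (𝕏s i : Measure (PathSpace d × PathSpace d)) ≪ 𝕏 := by
  obtain ⟨e, he⟩ := exists_surjective_nat ι
  exact ⟨_, isWeakSolution_mixture fun n => h (e n),
    he.forall.mpr (absolutelyContinuous_mixture (𝕏s ∘ e))⟩

theorem coincidence_anti {ε ε' : I} (h : ε' ≤ ε) : coincidence d ε ⊆ coincidence d ε' :=
  fun _ hp => restr_eq_restr_iff.mpr fun r hr => restr_eq_restr_iff.mp hp r (hr.trans h)

theorem not_pathwiseUniqueness_of_coincidence_lt_one {ε : I}
    {𝕐 : ProbabilityMeasure (PathSpace d × PathSpace d × PathSpace d)}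
    (h𝕐 : IsWeakCoupling u y 𝕎 𝕐)
    (h : (𝕐 : Measure (PathSpace d × PathSpace d × PathSpace d)) (coincidence d ε) < 1) :
    ¬ PathwiseUniqueness u y 𝕎 := fun huniq =>
  h.ne <| (measure_congr <| eventuallyEq_univ.mpr <|
    (huniq 𝕐 h𝕐).mono fun _ hp => congrArg (restr ε) hp).trans measure_univ

section Support

variable {𝕏 : ProbabilityMeasure (PathSpace d × PathSpace d)}

theorem ae_restr_mem_support_condLawUpTo (ε : I) :
    ∀ᵐ p ∂(𝕏 : Measure (PathSpace d × PathSpace d)),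
      restr ε p.1 ∈ (condLawUpTo 𝕏 ε p.2).support := by
  have hsupp := ae_mem_support_compProd ((𝕏 : Measure (PathSpace d × PathSpace d)).map Prod.snd)
    ((condDistrib Prod.fst Prod.snd (𝕏 : Measure (PathSpace d × PathSpace d))).map (restr ε))
  rw [Measure.compProd_map (measurable_restr ε),
    compProd_map_condDistrib measurable_fst.aemeasurable] at hsupp
  simpa only [Kernel.map_apply _ (measurable_restr ε)] using! ae_of_ae_map
    (measurable_snd.prodMk measurable_fst).aemeasurable
    (ae_of_ae_map (measurable_id.prodMap (measurable_restr ε)).aemeasurable hsupp)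

theorem measurableSet_condLawUpTo_nontrivial (ε : I) :
    MeasurableSet {W | (condLawUpTo 𝕏 ε W).support.Nontrivial} := by
  simpa only [Kernel.map_apply _ (measurable_restr ε)] using! measurableSet_nontrivial_support
    ((condDistrib Prod.fst Prod.snd (𝕏 : Measure (PathSpace d × PathSpace d))).map (restr ε))

theorem measure_not_nontrivial_support_le_coincidence
    {𝕐 : ProbabilityMeasure (PathSpace d × PathSpace d × PathSpace d)}
    (h𝕐 : IsWeakCoupling u y 𝕎 𝕐)
    (h₁ : (𝕐 : Measure (PathSpace d × PathSpace d × PathSpace d)).map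
      (fun p => (p.1, p.2.2)) ≪ 𝕏)
    (h₂ : (𝕐 : Measure (PathSpace d × PathSpace d × PathSpace d)).map
      (fun p => (p.2.1, p.2.2)) ≪ 𝕏) (ε : I) :
    (𝕎 : Measure (PathSpace d)) {W | ¬ (condLawUpTo 𝕏 ε W).support.Nontrivial} ≤
      (𝕐 : Measure (PathSpace d × PathSpace d × PathSpace d)) (coincidence d ε) := by
  have hnoise : (𝕎 : Measure (PathSpace d)) =
      (𝕐 : Measure (PathSpace d × PathSpace d × PathSpace d)).map fun p => p.2.2 :=
    h𝕐.1.marginal.symm.trans (Measure.map_map measurable_snd (by fun_prop))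
  have hmem₁ := ae_of_ae_map (by fun_prop) (h₁.ae_le (ae_restr_mem_support_condLawUpTo ε))
  have hmem₂ := ae_of_ae_map (by fun_prop) (h₂.ae_le (ae_restr_mem_support_condLawUpTo ε))
  rw [hnoise]
  refine (Measure.map_apply (by fun_prop) (measurableSet_condLawUpTo_nontrivial ε).compl).trans_le
    (measure_mono_ae ?_)
  filter_upwards [hmem₁, hmem₂] with p hp₁ hp₂ hp
  exact Set.not_nontrivial_iff.mp hp hp₁ hp₂

theorem exists_isWeakSolution_nontrivial_support
    (H : ∀ ε : I, 0 < ε → ∀ γ : ℝ≥0∞, 0 < γ →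
      ∃ 𝕐 : ProbabilityMeasure (PathSpace d × PathSpace d × PathSpace d),
        IsWeakCoupling u y 𝕎 𝕐 ∧
          (𝕐 : Measure (PathSpace d × PathSpace d × PathSpace d)) (coincidence d ε) ≤ γ) :
    ∃ 𝕏 : ProbabilityMeasure (PathSpace d × PathSpace d), IsWeakSolution u y 𝕎 𝕏 ∧
      ∀ ε : I, 0 < ε → ∀ᵐ W ∂(𝕎 : Measure (PathSpace d)),
        (condLawUpTo 𝕏 ε W).support.Nontrivial := by
  obtain ⟨ε, -, hε, hε₀⟩ := exists_seq_strictAnti_tendsto' (zero_lt_one (α := I))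
  obtain ⟨γ, -, hγ, hγ₀⟩ := exists_seq_strictAnti_tendsto' (zero_lt_one (α := ℝ≥0∞))
  choose 𝕐 h𝕐 hle using fun n => H (ε n) (hε n).1 (γ n) (hγ n).1
  obtain ⟨𝕏, h𝕏, habs⟩ := IsWeakSolution.exists_absolutelyContinuous
    (Sum.rec (fun n => (h𝕐 n).1) fun n => (h𝕐 n).2 : ∀ i : ℕ ⊕ ℕ, IsWeakSolution u y 𝕎 <|
      i.elim (fun n => (𝕐 n).map (f := fun p => (p.1, p.2.2)) (by fun_prop))
        fun n => (𝕐 n).map (f := fun p => (p.2.1, p.2.2)) (by fun_prop))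
  refine ⟨𝕏, h𝕏, fun ε' hε' => ?_⟩
  have hbound : ∀ᶠ n in atTop, (𝕎 : Measure (PathSpace d))
      {W | ¬ (condLawUpTo 𝕏 ε' W).support.Nontrivial} ≤ γ n := by
    filter_upwards [hε₀.eventually_le_const hε'] with n hn
    exact (measure_not_nontrivial_support_le_coincidence (h𝕐 n) (habs (.inl n)) (habs (.inr n))
      ε').trans ((measure_mono (coincidence_anti hn)).trans (hle n))
  exact nonpos_iff_eq_zero.mp (ge_of_tendsto hγ₀ hbound)

end Support

theorem isWeakCoupling_iff_isSelfCoupling (huniq : WeakUniqueness u y 𝕎)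
    {𝕏 : ProbabilityMeasure (PathSpace d × PathSpace d)} (h𝕏 : IsWeakSolution u y 𝕎 𝕏)
    (𝕐 : ProbabilityMeasure (PathSpace d × PathSpace d × PathSpace d)) :
    IsWeakCoupling u y 𝕎 𝕐 ↔ IsSelfCoupling (𝕏 : Measure (PathSpace d × PathSpace d)) 𝕐 := by
  constructor
  · rintro ⟨h₁, h₂⟩
    exact ⟨congrArg Subtype.val (huniq _ 𝕏 h₁ h𝕏), congrArg Subtype.val (huniq _ 𝕏 h₂ h𝕏)⟩
  · rintro ⟨h₁, h₂⟩
    exact ⟨by convert h𝕏; exact Subtype.ext h₁, by convert h𝕏; exact Subtype.ext h₂⟩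

theorem exists_isWeakCoupling_coincidence_eq_zero (huniq : WeakUniqueness u y 𝕎) (ε : I)
    (H : ∀ γ : ℝ≥0∞, 0 < γ →
      ∃ 𝕐 : ProbabilityMeasure (PathSpace d × PathSpace d × PathSpace d),
        IsWeakCoupling u y 𝕎 𝕐 ∧
          (𝕐 : Measure (PathSpace d × PathSpace d × PathSpace d)) (coincidence d ε) ≤ γ) :
    ∃ 𝕐 : ProbabilityMeasure (PathSpace d × PathSpace d × PathSpace d),
      IsWeakCoupling u y 𝕎 𝕐 ∧
        (𝕐 : Measure (PathSpace d × PathSpace d × PathSpace d)) (coincidence d ε) = 0 := by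
  obtain ⟨_, ⟨h𝕏, _⟩, _⟩ := H 1 one_pos
  have hself (γ : ℝ≥0∞) (hγ : 0 < γ) :
      ∃ π : Measure (PathSpace d × PathSpace d × PathSpace d), IsSelfCoupling _ π ∧
        π {p | restr ε p.1 = restr ε p.2.1} ≤ γ :=
    let ⟨𝕐, h𝕐, hle⟩ := H γ hγ
    ⟨𝕐, (isWeakCoupling_iff_isSelfCoupling huniq h𝕏 𝕐).mp h𝕐, hle⟩
  obtain ⟨π, hπ, hzero⟩ := exists_isSelfCoupling_eq_zero (measurable_restr ε) hself
  have : IsProbabilityMeasure (π.map fun p => (p.1, p.2.2)) := hπ.map_left ▸ inferInstance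
  have : IsProbabilityMeasure π := Measure.isProbabilityMeasure_of_map fun p => (p.1, p.2.2)
  exact ⟨⟨π, this⟩, (isWeakCoupling_iff_isSelfCoupling huniq h𝕏 _).mpr hπ, hzero⟩

end AdditiveSDE

end

theorem theorem2p4 (d : ℕ) (hd : 1 ≤ d)
    (𝕎 : ProbabilityMeasure (AdditiveSDE.PathSpace d))
    (h𝕎 : AdditiveSDE.IsRegularNoise 𝕎)
    (𝕌 : ProbabilityMeasure (AdditiveSDE.VelocityField d))
    (T : ℕ → I) (hTpos : ∀ n, 0 < T n) (hT : Tendsto T atTop (𝓝 0))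
    (hsep : ∀ᵐ W ∂(𝕎 : Measure (AdditiveSDE.PathSpace d)),
      AdditiveSDE.ExplosivelySeparating 𝕌 T W)
    (y : AdditiveSDE.Space d) :
    (∀ᵐ u ∂(𝕌 : Measure (AdditiveSDE.VelocityField d)),
      ¬ AdditiveSDE.PathwiseUniqueness u y 𝕎 ∧
      (∀ ε : I, 0 < ε → ∀ γ : ℝ≥0∞, 0 < γ →
        ∃ 𝕐 : ProbabilityMeasure
            (AdditiveSDE.PathSpace d × AdditiveSDE.PathSpace d × AdditiveSDE.PathSpace d),
          AdditiveSDE.IsWeakCoupling u y 𝕎 𝕐 ∧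
          (𝕐 : Measure (AdditiveSDE.PathSpace d × AdditiveSDE.PathSpace d ×
            AdditiveSDE.PathSpace d)) (AdditiveSDE.coincidence d ε) ≤ γ) ∧
      (∃ 𝕏 : ProbabilityMeasure (AdditiveSDE.PathSpace d × AdditiveSDE.PathSpace d),
        AdditiveSDE.IsWeakSolution u y 𝕎 𝕏 ∧
        ∀ ε : I, 0 < ε → ∀ᵐ W ∂(𝕎 : Measure (AdditiveSDE.PathSpace d)),
          (AdditiveSDE.condLawUpTo 𝕏 ε W).support.Nontrivial) ∧
      (AdditiveSDE.WeakUniqueness u y 𝕎 → ∀ ε : I, 0 < ε →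
        ∃ 𝕐 : ProbabilityMeasure
            (AdditiveSDE.PathSpace d × AdditiveSDE.PathSpace d × AdditiveSDE.PathSpace d),
          AdditiveSDE.IsWeakCoupling u y 𝕎 𝕐 ∧
          (𝕐 : Measure (AdditiveSDE.PathSpace d × AdditiveSDE.PathSpace d ×
            AdditiveSDE.PathSpace d)) (AdditiveSDE.coincidence d ε) = 0)) ∧
    ∀ᵐ q ∂((𝕌 : Measure (AdditiveSDE.VelocityField d)).prod
        (𝕎 : Measure (AdditiveSDE.PathSpace d))),
      ∀ ε : I, 0 < ε → ∃ X₁ X₂ : AdditiveSDE.PathSpace d,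
        AdditiveSDE.IsCaratheodorySolution q.1 y q.2 X₁ ∧
        AdditiveSDE.IsCaratheodorySolution q.1 y q.2 X₂ ∧
        AdditiveSDE.restr ε X₁ ≠ AdditiveSDE.restr ε X₂ := by
  obtain ⟨z, s, t, δ, h⟩ := AdditiveSDE.exists_isSeparating hd hTpos hT hsep y
  refine ⟨?_, h.ae_exists_isCaratheodorySolution_pair⟩
  filter_upwards [h.ae_exists_isWeakCoupling h𝕎] with u hu
  obtain ⟨𝕐, h𝕐, hle⟩ := hu 1 one_pos 2⁻¹ (by simp)
  exact ⟨AdditiveSDE.not_pathwiseUniqueness_of_coincidence_lt_one h𝕐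
      (hle.trans_lt ENNReal.one_half_lt_one), hu,
    AdditiveSDE.exists_isWeakSolution_nontrivial_support hu,
    fun huniq ε hε => AdditiveSDE.exists_isWeakCoupling_coincidence_eq_zero huniq ε (hu ε hε)⟩
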